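/- Let $K$ be a field and let $R_*=K\langle x_1,\dots,x_n,\partial\rangle$ be a $G$-algebra in the ordered variables $x_1,\dots,x_n,x_{n+1}=\partial$, that is, the quotient of the free algebra by the relations $x_jx_i=c_{ij}x_ix_j+d_{ij}$ ($i<j$) with $c_{ij}\in K\setminus\{0\}$ and $d_{ij}$ linear combinations of standard monomials $x_1^{\alpha_1}\cdots x_n^{\alpha_n}\partial^{\beta}$, such that for all $i<j<k$ the expression $c_{ik}c_{jk}d_{ij}x_k-x_kd_{ij}+c_{jk}x_jd_{ik}-c_{ij}d_{ik}x_j+d_{jk}x_i-c_{ij}c_{ik}x_id_{jk}$ reduces to zero by these relations, together with a monomial well-ordering $<$ that is admissible ($\mathrm{lm}(d_{ij})<x_ix_j$ whenever $d_{ij}\neq 0$) and in which $\partial$ is bigger than every monomial not involving $\partial$. Let $A_*\subset R_*$ be the subalgebra generated by $x_1,\dots,x_n$ and let $R=(A_*\setminus\{0\})^{-1}R_*\supset R_*$ be the Ore localization. Let $\theta$ be an involution of $R_*$ (a $K$-linear map with $\theta(ab)=\theta(b)\theta(a)$ and $\theta^2=\mathrm{id}$). For a matrix $B$ over $R_*$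 let $\widetilde\theta(B)$ be the matrix obtained by applying $\theta$ to the entries of the transpose of $B$. For a matrix $M$ over $R$ write ${}_RM$ for the left $R$-module generated by its rows. Order the monomials of the free module $R_*^{1\times p}$ position over term: $re_i<se_k$ iff $i<k$, or $i=k$ and $r<s$. If $M\in R^{p\times p}$ has full rank, that is, its rows are left linearly independent over $R$, let $M_*$ be a matrix over $R_*$ with ${}_RM_*={}_RM$. Let $\mathcal G({}_{R_*}M_*)$ be the reduced left Gröbner basis of the left $R_*$-module generated by the rows of $M_*$. Define $\mathcal G^*({}_RM)\in R_*^{p\times p}$ as the matrix whose $i$-th row is the element with the smallest leading monomial among those elements of $\mathcal G({}_{R_*}M_*)$ whose leading monomial has position $i$. Let $p\ge 1$ and let $M\in R^{p\times p}$ be of full rank. Then, whatever presentations over $R_*$ are used to form the two matrices, $\mathcal G^*({}_RM)$ exists, $\mathcal G^*(\widetilde\theta(\mathcal G^*({}_RM)))$ (formed from the left $R$-module generated by the rows of $\widetilde\theta(\mathcal G^*({}_RM))$) exists, and the following left ideals of $R$ are equal: $${}_R\langle \theta(\mathcal G^*({}_RM)_{p1}),\dots,\theta(\mathcal G^*({}_RM)_{pp})\rangle={}_R\langle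 \mathcal G^*(\widetilde\theta(\mathcal G^*({}_RM)))_{pp}\rangle .$$ -/

import Mathlib

/-! ## G-algebras -/

/-- The structure constants of a `K`-algebra with generators `x_0, …, x_{n-1}` and relations
`x_j x_i = c_ij x_i x_j + d_ij` for `i < j`.  The polynomial `d_ij` is given by its coefficients
with respect to the standard monomials `x_0 ^ α_0 ⋯ x_{n-1} ^ α_{n-1}`.
Only the entries with `i < j` are used. -/
structure GData (K : Type*) [Field K] (n : ℕ) where
  c : Fin n → Fin n → K
  d : Fin n → Fin n → ((Fin n →₀ ℕ) →₀ K)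

namespace GData

variable {K : Type*} [Field K] {n : ℕ}

/-- The word `x_{w_1} x_{w_2} ⋯` in the free algebra. -/
noncomputable def word (K : Type*) [Field K] {n : ℕ} (w : List (Fin n)) : FreeAlgebra K (Fin n) :=
  (w.map (FreeAlgebra.ι K)).prod

/-- The coefficient of the word `w` in an element of the free algebra. -/
noncomputable def wordCoeff (f : FreeAlgebra K (Fin n)) (w : List (Fin n)) : K :=
  (FreeAlgebra.equivMonoidAlgebraFreeMonoid f).coeff (FreeMonoid.ofList w)

/-- The standard monomial `x_0 ^ α_0 ⋯ x_{n-1} ^ α_{n-1}` in the free algebra. -/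
noncomputable def freeMon (K : Type*) [Field K] {n : ℕ} (α : Fin n →₀ ℕ) :
    FreeAlgebra K (Fin n) :=
  (List.ofFn fun i => FreeAlgebra.ι K i ^ α i).prod

/-- The combination of standard monomials with prescribed coefficients, in the free algebra. -/
noncomputable def freePoly (p : (Fin n →₀ ℕ) →₀ K) : FreeAlgebra K (Fin n) :=
  p.sum fun α a => a • freeMon K α

variable (g : GData K n)

/-- `d_ij` as an element of the free algebra. -/
noncomputable def dFree (i j : Fin n) : FreeAlgebra K (Fin n) := freePoly (g.d i j)

/-- The right-hand side `c_ij x_i x_j + d_ij` of the relation for `x_j x_i`. -/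
noncomputable def rhs (i j : Fin n) : FreeAlgebra K (Fin n) :=
  g.c i j • (FreeAlgebra.ι K i * FreeAlgebra.ι K j) + g.dFree i j

/-- The defining relations `x_j x_i = c_ij x_i x_j + d_ij`, `i < j`. -/
inductive Rel : FreeAlgebra K (Fin n) → FreeAlgebra K (Fin n) → Prop
  | mk (i j : Fin n) (hij : i < j) :
      Rel (FreeAlgebra.ι K j * FreeAlgebra.ι K i) (g.rhs i j)

/-- One reduction step in the free algebra: for some `i < j`, an occurrence of `x_j x_i` inside a
word `u x_j x_i v` that occurs in `f` is replaced by `c_ij x_i x_j + d_ij`. -/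
def Step (f f' : FreeAlgebra K (Fin n)) : Prop :=
  ∃ (u v : List (Fin n)) (i j : Fin n), i < j ∧ wordCoeff f (u ++ [j, i] ++ v) ≠ 0 ∧
    f' = f - wordCoeff f (u ++ [j, i] ++ v) •
      (word K u * (FreeAlgebra.ι K j * FreeAlgebra.ι K i - g.rhs i j) * word K v)

/-- `f` reduces to zero by finitely many reduction steps. -/
def ReducesToZero (f : FreeAlgebra K (Fin n)) : Prop :=
  Relation.ReflTransGen g.Step f 0

/-- The expression
`c_ik c_jk d_ij x_k - x_k d_ij + c_jk x_j d_ik - c_ij d_ik x_j + d_jk x_i - c_ij c_ik x_i d_jk`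
of the nondegeneracy conditions. -/
noncomputable def ndc (i j k : Fin n) : FreeAlgebra K (Fin n) :=
  (g.c i k * g.c j k) • (g.dFree i j * FreeAlgebra.ι K k)
    - FreeAlgebra.ι K k * g.dFree i j
    + g.c j k • (FreeAlgebra.ι K j * g.dFree i k)
    - g.c i j • (g.dFree i k * FreeAlgebra.ι K j)
    + g.dFree j k * FreeAlgebra.ι K i
    - (g.c i j * g.c i k) • (FreeAlgebra.ι K i * g.dFree j k)

/-- The monomial ordering `m` is admissible: `lm (d_ij) < x_i x_j` for `i < j`
with `d_ij ≠ 0`. -/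
def Admissible (m : MonomialOrder (Fin n)) : Prop :=
  ∀ i j, i < j → ∀ α ∈ (g.d i j).support,
    m.toSyn α < m.toSyn (Finsupp.single i 1 + Finsupp.single j 1)

/-- The data `g` define a G-algebra, with admissible monomial ordering `m`. -/
structure IsGAlgebra (m : MonomialOrder (Fin n)) : Prop where
  c_ne_zero : ∀ i j, i < j → g.c i j ≠ 0
  nondegenerate : ∀ i j k, i < j → j < k → g.ReducesToZero (g.ndc i j k)
  admissible : g.Admissible m

/-- The algebra `K⟨x_0, …, x_{n-1} ∣ x_j x_i = c_ij x_i x_j + d_ij (i < j)⟩`. -/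
def Alg : Type _ := RingQuot g.Rel

noncomputable instance : Ring g.Alg := inferInstanceAs (Ring (RingQuot g.Rel))

noncomputable instance : Algebra K g.Alg := inferInstanceAs (Algebra K (RingQuot g.Rel))

/-- The quotient map from the free algebra. -/
noncomputable def proj : FreeAlgebra K (Fin n) →ₐ[K] g.Alg := RingQuot.mkAlgHom K g.Rel

/-- The generator `x_i` of the algebra. -/
noncomputable def gen (i : Fin n) : g.Alg := g.proj (FreeAlgebra.ι K i)

/-- The element of the algebra with the given coefficients on the standard monomials. -/
noncomputable def ofCoeffs (p : (Fin n →₀ ℕ) →₀ K) : g.Alg := g.proj (freePoly p)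

/-- The coefficients of `f` with respect to the standard monomials.  The standard monomials of a
G-algebra form a `K`-basis, so that `ofCoeffs` is bijective and `coeffs` is its inverse. -/
noncomputable def coeffs (f : g.Alg) : (Fin n →₀ ℕ) →₀ K := Function.invFun g.ofCoeffs f

/-! ## Gröbner bases of submodules of free left modules -/

variable {p : ℕ} (m : MonomialOrder (Fin n))

/-- The coefficient of a vector at the module monomial `x ^ α e_i`, written `(i, α)`. -/
noncomputable def vcoeff (f : Fin p → g.Alg) (μ : Fin p × (Fin n →₀ ℕ)) : K :=
  g.coeffs (f μ.1) μ.2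

end GData

/-- The position-over-term ordering:
`x ^ α e_i ≤ x ^ β e_j` iff `i < j`, or `i = j` and `x ^ α ≤ x ^ β`. -/
def potLE {n p : ℕ} (m : MonomialOrder (Fin n)) (μ ν : Fin p × (Fin n →₀ ℕ)) : Prop :=
  μ.1 < ν.1 ∨ (μ.1 = ν.1 ∧ m.toSyn μ.2 ≤ m.toSyn ν.2)

/-- Divisibility of module monomials. -/
def monDvd {n p : ℕ} (μ ν : Fin p × (Fin n →₀ ℕ)) : Prop :=
  μ.1 = ν.1 ∧ μ.2 ≤ ν.2

namespace GData

variable {K : Type*} [Field K] {n : ℕ} (g : GData K n) {p : ℕ} (m : MonomialOrder (Fin n))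

/-- `μ` is the leading monomial of the (nonzero) vector `f`; then `μ.1` is its leading position. -/
def IsLM (f : Fin p → g.Alg) (μ : Fin p × (Fin n →₀ ℕ)) : Prop :=
  g.vcoeff f μ ≠ 0 ∧ ∀ ν, g.vcoeff f ν ≠ 0 → potLE m ν μ

/-- `G` is the reduced left Gröbner basis of the submodule `N` of the free left module, with
respect to the position-over-term ordering. -/
structure IsReducedGroebner (N : Submodule g.Alg (Fin p → g.Alg)) (G : Set (Fin p → g.Alg)) :
    Prop where
  finite : G.Finite
  subset : ∀ h ∈ G, h ∈ N ∧ h ≠ 0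
  groebner : ∀ f ∈ N, f ≠ 0 → ∃ h ∈ G, ∃ μ ν, g.IsLM m h μ ∧ g.IsLM m f ν ∧ monDvd μ ν
  monic : ∀ h ∈ G, ∀ μ, g.IsLM m h μ → g.vcoeff h μ = 1
  reduced : ∀ h ∈ G, ∀ h' ∈ G, h' ≠ h → ∀ μ, g.IsLM m h' μ → ∀ ν, g.vcoeff h ν ≠ 0 →
    ¬ monDvd μ ν

end GData

/-- The left module generated by the rows of a matrix. -/
def rowModule {S : Type*} [Ring S] {a b : ℕ} (M : Matrix (Fin a) (Fin b) S) :
    Submodule S (Fin b → S) :=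
  Submodule.span S (Set.range M.row)

namespace GData

variable {K : Type*} [Field K] {n : ℕ} (g : GData K n) {p : ℕ} (m : MonomialOrder (Fin n))

/-- `B` is the square matrix `G^*` obtained from a matrix `Ms` over the G-algebra: its `i`-th row
`b_i` is the element with the smallest leading monomial among the elements with leading position
`i` of the reduced Gröbner basis of the left module generated by the rows of `Ms`. -/
def IsGStar {l : ℕ} (Ms : Matrix (Fin l) (Fin p) g.Alg) (B : Matrix (Fin p) (Fin p) g.Alg) :
    Prop :=
  ∃ G, g.IsReducedGroebner m (rowModule Ms) G ∧
    ∀ i, B.row i ∈ G ∧ ∃ α, g.IsLM m (B.row i) (i, α) ∧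
      ∀ h ∈ G, ∀ β, g.IsLM m h (i, β) → m.toSyn α ≤ m.toSyn β

/-- A `K`-linear involutive anti-automorphism. -/
structure IsInvolution (θ : g.Alg →ₗ[K] g.Alg) : Prop where
  anti : ∀ a b, θ (a * b) = θ b * θ a
  invol : ∀ a, θ (θ a) = a

/-- `θ` applied to the entries of the transpose of a matrix. -/
noncomputable def thetaTilde (θ : g.Alg →ₗ[K] g.Alg) {a b : ℕ} (M : Matrix (Fin a) (Fin b) g.Alg) :
    Matrix (Fin b) (Fin a) g.Alg :=
  M.transpose.map θ

end GData

/-! ## The localization at all variables but the last one -/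

namespace GData

variable {K : Type*} [Field K] {n : ℕ} (g : GData K (n + 1))

/-- The last variable `∂` is bigger than every monomial that does not involve it. -/
def LastDominates (m : MonomialOrder (Fin (n + 1))) : Prop :=
  ∀ α : Fin (n + 1) →₀ ℕ, α (Fin.last n) = 0 → m.toSyn α < m.toSyn (Finsupp.single (Fin.last n) 1)

/-- The subalgebra `A_*` generated by all variables except the last one. -/
noncomputable def Astar : Subalgebra K g.Alg :=
  Algebra.adjoin K (Set.range fun i : Fin n => g.gen i.castSucc)

/-- The ring `R` with the embedding `j` of the G-algebra `R_*` is the Ore localization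
`(A_* ∖ {0})⁻¹ R_*`: the nonzero elements of `A_*` become invertible, and every element of `R` is
a left fraction `s⁻¹ f`. -/
structure IsOreLocalizedAt {R : Type*} [Ring R] (j : g.Alg →+* R) : Prop where
  injective : Function.Injective j
  isUnit : ∀ s ∈ g.Astar, s ≠ 0 → IsUnit (j s)
  fraction : ∀ r : R, ∃ s ∈ g.Astar, s ≠ 0 ∧ ∃ f, j s * r = j f

end GData

/-! Write `B` for the first matrix and `C` for the second. Under position over term, a vector with
leading position `i` has zeros after position `i`, so `B` is lower triangular with nonzero diagonal,
and its transpose under `θ` is upper triangular with nonzero diagonal. The last column of that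
transpose consists of the `θ (B_pk)`. Hence the left ideal on the left-hand side is the projection
to the last coordinate of the row module from which `C` is formed.

It remains to see that `C_pp` generates this projection (`IsGStar.span_last_eq_map_proj`). A vector
with nonzero last entry has leading position `p`, so `C_pp` has the smallest leading monomial among
all nonzero last entries. As `∂` dominates the other variables, it also has the smallest degree in
`∂`. Over `R` the nonzero elements of `A_*` are units, so division with remainder by degree in `∂`
is possible, and an element of minimal degree generates its left ideal
(`ideal_eq_span_of_ddeg_minimal`).

For existence, left ideals of `R` are principal, so `R` has the strong rank condition, and a square
matrix of full rank has a nonzero multiple of each `e_i` in its row module. Clearing denominators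
gives elements of every leading position. Reduced Gröbner bases come from Dickson's lemma.

All of this uses leading monomials, hence the fact that standard monomials form a `K`-basis
(`ofCoeffs_bijective`). This is Bergman's diamond lemma: the nondegeneracy conditions resolve the
overlaps `x_k x_j x_i`, so rewriting defines a normal form that vanishes on the relations.
Admissibility then makes leading exponents additive (`IsLead.mul`), so the algebra is a domain and
the degree in `∂` is additive. -/

/-! ## Words, multidegrees and inversions -/

namespace GData

variable {K : Type*} [Field K] {n : ℕ}

/-- The exponent vector of the commutative image of a word. -/
noncomputable def mdeg (w : List (Fin n)) : Fin n →₀ ℕ :=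
  (w.map fun i => Finsupp.single i 1).sum

@[simp] lemma mdeg_nil : mdeg ([] : List (Fin n)) = 0 := rfl

@[simp] lemma mdeg_cons (i : Fin n) (w : List (Fin n)) :
    mdeg (i :: w) = Finsupp.single i 1 + mdeg w := by simp [mdeg]

@[simp] lemma mdeg_append (u v : List (Fin n)) : mdeg (u ++ v) = mdeg u + mdeg v := by
  simp [mdeg]

lemma mdeg_apply (w : List (Fin n)) (i : Fin n) : mdeg w i = w.count i := by
  induction w with
  | nil => simp
  | cons a w ih =>
    rw [mdeg_cons, Finsupp.add_apply, ih, List.count_cons, Finsupp.single_apply, add_comm]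
    simp [beq_iff_eq]

/-- The number of inversions of a word. -/
def inv : List (Fin n) → ℕ
  | [] => 0
  | a :: l => inv l + l.countP (· < a)

lemma inv_swap_lt (u v : List (Fin n)) {i j : Fin n} (hij : i < j) :
    inv (u ++ i :: j :: v) < inv (u ++ j :: i :: v) := by
  induction u with
  | nil => simp [inv, hij, hij.not_gt]; omega
  | cons a u ih =>
    have : (u ++ i :: j :: v).countP (· < a) = (u ++ j :: i :: v).countP (· < a) :=
      List.Perm.countP_eq _ ((List.Perm.swap j i v).append_left u)
    simp only [List.cons_append, inv, this]
    omega

/-- The ordering of words by multidegree, then by the number of inversions. -/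
noncomputable def rank (m : MonomialOrder (Fin n)) (w : List (Fin n)) : m.syn ×ₗ ℕ :=
  toLex (m.toSyn (mdeg w), inv w)

/-- A rewriting yields two kinds of words: the swapped word, with equal multidegree but fewer
inversions, and words from `d_ij`, with smaller multidegree by admissibility. The lexicographic rank
decreases in both cases. -/
lemma rank_swap_lt (m : MonomialOrder (Fin n)) (u v : List (Fin n)) {i j : Fin n} (hij : i < j) :
    rank m (u ++ i :: j :: v) < rank m (u ++ j :: i :: v) := by
  refine Prod.Lex.toLex_lt_toLex.2 (Or.inr ⟨?_, inv_swap_lt u v hij⟩)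
  simp [add_left_comm]

lemma rank_lt_of_mdeg_lt (m : MonomialOrder (Fin n)) {w w' : List (Fin n)}
    (h : m.toSyn (mdeg w) < m.toSyn (mdeg w')) : rank m w < rank m w' :=
  Prod.Lex.toLex_lt_toLex.2 (Or.inl h)

/-- The word `x_0 ^ α_0 ⋯ x_{n-1} ^ α_{n-1}`. -/
def monWord (α : Fin n →₀ ℕ) : List (Fin n) :=
  (List.ofFn fun i => List.replicate (α i) i).flatten

lemma word_append (u v : List (Fin n)) : word K (u ++ v) = word K u * word K v := by
  simp [word]

lemma word_cons (i : Fin n) (v : List (Fin n)) :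
    word K (i :: v) = FreeAlgebra.ι K i * word K v := by
  simp [word]

@[simp] lemma word_nil : word K ([] : List (Fin n)) = 1 := rfl

lemma word_monWord (α : Fin n →₀ ℕ) : word K (monWord α) = freeMon K α := by
  simp only [word, monWord, freeMon, List.map_flatten, List.prod_flatten,
    List.map_ofFn]
  congr 2
  funext i
  simp

lemma mdeg_monWord (α : Fin n →₀ ℕ) : mdeg (monWord α) = α := by
  ext i
  rw [mdeg_apply, monWord, List.count_flatten, List.map_ofFn, List.sum_ofFn]
  simp [List.count_replicate]

lemma pairwise_monWord (α : Fin n →₀ ℕ) : (monWord α).Pairwise (· ≤ ·) := by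
  rw [monWord, List.pairwise_flatten]
  constructor
  · intro l hl
    obtain ⟨i, rfl⟩ := (List.mem_ofFn' _ _).1 hl
    exact List.pairwise_replicate.2 (Or.inr le_rfl)
  · rw [List.pairwise_ofFn]
    intro i j hij a ha b hb
    rw [List.eq_of_mem_replicate ha, List.eq_of_mem_replicate hb]
    exact hij.le

lemma eq_monWord_of_pairwise {w : List (Fin n)} (hw : w.Pairwise (· ≤ ·)) :
    w = monWord (mdeg w) := by
  refine List.Perm.eq_of_pairwise' hw (pairwise_monWord _) ?_
  rw [List.perm_iff_count]
  intro i
  rw [← mdeg_apply, ← mdeg_apply, mdeg_monWord]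

/-- `(u, j, i, v)` is a descent of `w`. -/
def IsDescent (w : List (Fin n)) (d : List (Fin n) × Fin n × Fin n × List (Fin n)) : Prop :=
  d.2.2.1 < d.2.1 ∧ w = d.1 ++ d.2.1 :: d.2.2.1 :: d.2.2.2

lemma pairwise_of_forall_not_isDescent {w : List (Fin n)} (h : ¬ ∃ d, IsDescent w d) :
    w.Pairwise (· ≤ ·) := by
  rw [← List.isChain_iff_pairwise]
  induction w with
  | nil => simp
  | cons a w ih =>
    have h1 := ih (fun ⟨d, hd⟩ => h ⟨(a :: d.1, d.2), hd.1, by simpa using hd.2⟩)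
    cases w with
    | nil => simp
    | cons b w =>
      refine List.isChain_cons_cons.2 ⟨?_, h1⟩
      by_contra hab
      exact h ⟨([], a, b, w), not_le.1 hab, rfl⟩

lemma not_isDescent_of_pairwise {w : List (Fin n)} (h : w.Pairwise (· ≤ ·)) :
    ¬ ∃ d, IsDescent w d := by
  rintro ⟨⟨u, j, i, v⟩, hij, rfl⟩
  have := (List.pairwise_append.1 h).2.1
  simp only [List.pairwise_cons, List.mem_cons, forall_eq_or_imp] at this
  exact absurd this.1.1 (not_le.2 hij)

lemma basisFreeMonoid_apply (w : List (Fin n)) :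
    FreeAlgebra.basisFreeMonoid K (Fin n) (FreeMonoid.ofList w) = word K w := by
  rw [FreeAlgebra.basisFreeMonoid]
  simp only [Module.Basis.map_apply, Finsupp.coe_basisSingleOne]
  show FreeAlgebra.equivMonoidAlgebraFreeMonoid.symm (MonoidAlgebra.ofCoeff (Finsupp.single _ 1)) = _
  rw [AlgEquiv.symm_apply_eq]
  induction w with
  | nil => simp; rfl
  | cons a w ih =>
    rw [word_cons, map_mul, ← ih]
    simp [FreeAlgebra.equivMonoidAlgebraFreeMonoid]

end GData

/-! ## Normal forms and the diamond lemma -/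

namespace GData

variable {K : Type*} [Field K] {n : ℕ} (g : GData K n) (m : MonomialOrder (Fin n))

/-- The relator `x_j x_i - (c_ij x_i x_j + d_ij)`. -/
noncomputable def relator (i j : Fin n) : FreeAlgebra K (Fin n) :=
  FreeAlgebra.ι K j * FreeAlgebra.ι K i - g.rhs i j

open Classical in
/-- The normal form of a word, by repeatedly rewriting a descent. -/
noncomputable def nfWord : List (Fin n) → ((Fin n →₀ ℕ) →₀ K) :=
  (InvImage.wf (rank m) wellFounded_lt).fix fun w rec =>
    -- The value `0` only makes the recursion total without assuming admissibility. For admissible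
    -- data the guard always holds where `E` is used.
    let E : List (Fin n) → ((Fin n →₀ ℕ) →₀ K) := fun w' =>
      if h : rank m w' < rank m w then rec w' h else 0
    if h : ∃ d, IsDescent w d then
      let d := h.choose
      g.c d.2.2.1 d.2.1 • E (d.1 ++ d.2.2.1 :: d.2.1 :: d.2.2.2) +
        (g.d d.2.2.1 d.2.1).sum fun α a => a • E (d.1 ++ monWord α ++ d.2.2.2)
    else Finsupp.single (mdeg w) 1

/-- The normal form of an element of the free algebra. -/
noncomputable def nf : FreeAlgebra K (Fin n) →ₗ[K] ((Fin n →₀ ℕ) →₀ K) :=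
  (FreeAlgebra.basisFreeMonoid K (Fin n)).constr K fun w => g.nfWord m w.toList

lemma nf_word (w : List (Fin n)) : g.nf m (word K w) = g.nfWord m w := by
  rw [← basisFreeMonoid_apply, nf, Module.Basis.constr_basis]
  rfl

variable {g m}

lemma map_rhs {V : Type*} [AddCommGroup V] [Module K V] (L : FreeAlgebra K (Fin n) →ₗ[K] V)
    (i j : Fin n) : L (g.rhs i j) = g.c i j • L (word K [i, j]) +
      (g.d i j).sum fun α a => a • L (word K (monWord α)) := by
  rw [rhs, dFree, freePoly, map_add, map_smul, map_finsuppSum]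
  simp only [map_smul, word_monWord]
  simp [word]

/-- The linear map `f ↦ a f b`. -/
noncomputable def sandwich (a b : FreeAlgebra K (Fin n)) :
    FreeAlgebra K (Fin n) →ₗ[K] FreeAlgebra K (Fin n) :=
  LinearMap.mulLeftRight K (a, b)

@[simp] lemma sandwich_apply (a b f : FreeAlgebra K (Fin n)) : sandwich a b f = a * f * b := by
  simp [sandwich]

lemma rank_monWord_lt (hg : g.Admissible m) {i j : Fin n} (hij : i < j) (u v : List (Fin n))
    {α : Fin n →₀ ℕ} (hα : α ∈ (g.d i j).support) :
    m.toSyn (mdeg (u ++ monWord α ++ v)) < m.toSyn (mdeg (u ++ j :: i :: v)) := by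
  have := hg i j hij α hα
  simp only [mdeg_append, mdeg_cons, mdeg_monWord, map_add] at this ⊢
  have h2 := add_lt_add_left (add_lt_add_right this (m.toSyn (mdeg u))) (m.toSyn (mdeg v))
  convert h2 using 1
  abel

lemma nfWord_of_pairwise {w : List (Fin n)} (hw : w.Pairwise (· ≤ ·)) :
    g.nfWord m w = Finsupp.single (mdeg w) 1 := by
  rw [nfWord, WellFounded.fix_eq, dif_neg (not_isDescent_of_pairwise hw)]

/-- This is the recursion of `nfWord` unfolded once. It concerns only the descent picked by choice;
independence of that choice is what the diamond lemma supplies. -/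
lemma exists_nf_descent (hg : g.Admissible m) {w : List (Fin n)} (h : ∃ d, IsDescent w d) :
    ∃ u j i v, i < j ∧ w = u ++ j :: i :: v ∧
      g.nf m (word K u * g.relator i j * word K v) = 0 := by
  have hd := h.choose_spec
  refine ⟨h.choose.1, h.choose.2.1, h.choose.2.2.1, h.choose.2.2.2, hd.1, hd.2, ?_⟩
  have e : word K h.choose.1 * (FreeAlgebra.ι K h.choose.2.1 * FreeAlgebra.ι K h.choose.2.2.1) *
      word K h.choose.2.2.2 = word K w := by
    conv_rhs => rw [hd.2]
    simp [word_append, word_cons, mul_assoc]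
  rw [relator, mul_sub, sub_mul, map_sub, e, sub_eq_zero, nf_word]
  have e2 := map_rhs (g := g) ((g.nf m).comp (sandwich (word K h.choose.1)
    (word K h.choose.2.2.2))) h.choose.2.2.1 h.choose.2.1
  simp only [LinearMap.comp_apply, sandwich_apply, ← word_append, nf_word] at e2
  rw [e2, List.append_assoc, List.cons_append, List.cons_append, List.nil_append]
  conv_lhs => rw [nfWord, WellFounded.fix_eq, dif_pos h]
  have hw := hd.2
  dsimp only
  congr 1
  · have := rank_swap_lt m h.choose.1 h.choose.2.2.2 hd.1
    rw [← hw] at this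
    rw [dif_pos this, nfWord]
  · refine Finset.sum_congr rfl fun α hα => ?_
    have := rank_lt_of_mdeg_lt m (rank_monWord_lt hg hd.1 h.choose.1 h.choose.2.2.2 hα)
    rw [← hw] at this
    simp only [dif_pos this, nfWord]

variable (g m)

/-- The span of the words of multidegree less than `D`. -/
def wordsLT (D : m.syn) : Submodule K (FreeAlgebra K (Fin n)) :=
  Submodule.span K (word K '' {w | m.toSyn (mdeg w) < D})

/-- The span of the two-sided multiples of relators whose leading word has multidegree less
than `D`. -/
def relatorsLT (D : m.syn) : Submodule K (FreeAlgebra K (Fin n)) :=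
  Submodule.span K {f | ∃ u j i v, i < j ∧ m.toSyn (mdeg (u ++ j :: i :: v)) < D ∧
    f = word K u * g.relator i j * word K v}

variable {g m}

lemma mem_wordsLT_iff {D : m.syn} {f : FreeAlgebra K (Fin n)} :
    f ∈ wordsLT m D ↔ ∀ w, wordCoeff f w ≠ 0 → m.toSyn (mdeg w) < D := by
  have : word K '' {w | m.toSyn (mdeg w) < D} = (FreeAlgebra.basisFreeMonoid K (Fin n)) ''
      {w : FreeMonoid (Fin n) | m.toSyn (mdeg w.toList) < D} := by
    ext x
    constructor
    · rintro ⟨w, hw, rfl⟩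
      exact ⟨FreeMonoid.ofList w, hw, basisFreeMonoid_apply w⟩
    · rintro ⟨w, hw, rfl⟩
      exact ⟨w.toList, hw, (basisFreeMonoid_apply w.toList).symm⟩
  rw [wordsLT, this, Module.Basis.mem_span_image]
  constructor
  · intro h w hw
    exact h (Finsupp.mem_support_iff.2 hw)
  · intro h w hw
    exact h w.toList (Finsupp.mem_support_iff.1 hw)

lemma word_mem_wordsLT {D : m.syn} {w : List (Fin n)} (h : m.toSyn (mdeg w) < D) :
    word K w ∈ wordsLT m D := Submodule.subset_span ⟨w, h, rfl⟩

lemma sandwich_mem_wordsLT {D E : m.syn} {f : FreeAlgebra K (Fin n)} (hf : f ∈ wordsLT m D)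
    (u v : List (Fin n)) (hE : m.toSyn (mdeg u + mdeg v) + D ≤ E) :
    word K u * f * word K v ∈ wordsLT m E := by
  rw [← sandwich_apply]
  refine (Submodule.span_le (p := (wordsLT m E).comap (sandwich (word K u) (word K v)))).2 ?_ hf
  rintro _ ⟨w, hw, rfl⟩
  simp only [SetLike.mem_coe, Submodule.mem_comap, sandwich_apply, ← word_append]
  refine word_mem_wordsLT (lt_of_lt_of_le ?_ hE)
  have := add_lt_add_right hw (m.toSyn (mdeg u + mdeg v))
  refine lt_of_eq_of_lt ?_ this
  simp only [mdeg_append, map_add]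
  abel

lemma dFree_mem_wordsLT (hg : g.Admissible m) {i j : Fin n} (hij : i < j) :
    g.dFree i j ∈ wordsLT m (m.toSyn (Finsupp.single i 1 + Finsupp.single j 1)) := by
  refine Submodule.sum_mem _ fun α hα => Submodule.smul_mem _ _ ?_
  rw [← word_monWord]
  exact word_mem_wordsLT (by rw [mdeg_monWord]; exact hg i j hij α hα)

lemma sandwich_relator_mem_wordsLT (hg : g.Admissible m) {i j : Fin n} (hij : i < j)
    (u v : List (Fin n)) {D : m.syn} (hD : m.toSyn (mdeg (u ++ j :: i :: v)) < D) :
    word K u * g.relator i j * word K v ∈ wordsLT m D := by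
  rw [relator, mul_sub, sub_mul]
  refine Submodule.sub_mem _ ?_ ?_
  · have : word K u * (FreeAlgebra.ι K j * FreeAlgebra.ι K i) * word K v =
      word K (u ++ j :: i :: v) := by simp [word, mul_assoc]
    rw [this]
    exact word_mem_wordsLT hD
  · rw [← sandwich_apply, rhs, map_add, map_smul]
    refine Submodule.add_mem _ (Submodule.smul_mem _ _ ?_) ?_
    · have : sandwich (word K u) (word K v) (FreeAlgebra.ι K i * FreeAlgebra.ι K j) =
        word K (u ++ i :: j :: v) := by simp [word, mul_assoc]
      rw [this]
      refine word_mem_wordsLT (lt_of_eq_of_lt ?_ hD)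
      simp [add_left_comm]
    · rw [sandwich_apply]
      refine sandwich_mem_wordsLT (dFree_mem_wordsLT hg hij) u v (le_trans (le_of_eq ?_) hD.le)
      simp only [mdeg_append, mdeg_cons, map_add]
      abel

/-- Each reduction step subtracts a multiple of a relator whose leading word occurs in `f`, hence
lies below `D`, and the result stays below `D`. Reduction to zero thus becomes a certificate
strictly below the overlap, where the induction hypothesis applies. -/
lemma mem_relatorsLT_of_reducesToZero (hg : g.Admissible m) {D : m.syn}
    {f : FreeAlgebra K (Fin n)} (h : g.ReducesToZero f) (hf : f ∈ wordsLT m D) :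
    f ∈ g.relatorsLT m D := by
  unfold ReducesToZero at h
  induction h using Relation.ReflTransGen.head_induction_on with
  | refl => exact Submodule.zero_mem _
  | @head f' _ hs _ ih =>
    obtain ⟨u, v, i, j, hij, hc, rfl⟩ := hs
    have hlt := mem_wordsLT_iff.1 hf _ hc
    have e : u ++ [j, i] ++ v = u ++ j :: i :: v := by simp
    have e' := e ▸ hlt
    have h1 := ih (Submodule.sub_mem _ hf
      (Submodule.smul_mem _ _ (sandwich_relator_mem_wordsLT hg hij u v e')))
    have h2 := Submodule.add_mem _ h1 (Submodule.smul_mem _ (wordCoeff f' (u ++ [j, i] ++ v))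
      (Submodule.subset_span ⟨u, j, i, v, hij, e', rfl⟩))
    rw [relator, sub_add_cancel] at h2
    exact h2

end GData

/-! ### Resolution of overlaps and independence of the chosen descent. -/

namespace GData

variable {K : Type*} [Field K] {n : ℕ} {g : GData K n} {m : MonomialOrder (Fin n)}

lemma ndc_mem_wordsLT (hg : g.Admissible m) {i j k : Fin n} (hij : i < j) (hjk : j < k) :
    g.ndc i j k ∈ wordsLT m (m.toSyn (mdeg [k, j, i])) := by
  have h1 : ∀ {a b c : Fin n} (_ : a < b), mdeg [a, b, c] = mdeg [k, j, i] →
      FreeAlgebra.ι K c * g.dFree a b ∈ wordsLT m (m.toSyn (mdeg [k, j, i])) := by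
    intro a b c hab h
    have := sandwich_mem_wordsLT (dFree_mem_wordsLT hg hab) [c] []
      (E := m.toSyn (mdeg [k, j, i])) (by
        rw [← h, ← map_add]; apply le_of_eq; congr 1
        simp only [mdeg_cons, mdeg_nil]; abel)
    simpa [word] using this
  have h2 : ∀ {a b c : Fin n} (_ : a < b), mdeg [a, b, c] = mdeg [k, j, i] →
      g.dFree a b * FreeAlgebra.ι K c ∈ wordsLT m (m.toSyn (mdeg [k, j, i])) := by
    intro a b c hab h
    have := sandwich_mem_wordsLT (dFree_mem_wordsLT hg hab) [] [c]
      (E := m.toSyn (mdeg [k, j, i])) (by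
        rw [← h, ← map_add]; apply le_of_eq; congr 1
        simp only [mdeg_cons, mdeg_nil]; abel)
    simpa [word] using this
  have e1 : mdeg [i, j, k] = mdeg [k, j, i] := by simp only [mdeg_cons, mdeg_nil]; abel
  have e2 : mdeg [i, k, j] = mdeg [k, j, i] := by simp only [mdeg_cons, mdeg_nil]; abel
  have e3 : mdeg [j, k, i] = mdeg [k, j, i] := by simp only [mdeg_cons, mdeg_nil]; abel
  have hik := hij.trans hjk
  unfold ndc
  refine Submodule.sub_mem _ (Submodule.add_mem _ (Submodule.sub_mem _ (Submodule.add_mem _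
    (Submodule.sub_mem _ ?_ ?_) ?_) ?_) ?_) ?_
  · exact Submodule.smul_mem _ _ (h2 hij e1)
  · exact h1 hij e1
  · exact Submodule.smul_mem _ _ (h1 hik e2)
  · exact Submodule.smul_mem _ _ (h2 hik e2)
  · exact h2 hjk e3
  · exact Submodule.smul_mem _ _ (h1 hjk e3)

/-- The two rewritings of `x_k x_j x_i` are both pushed down to `x_i x_j x_k`, whose coefficients
agree and cancel. The lower terms left over form `ndc`, and the four relators record the rewritings
used on the way. -/
lemma overlap_eq (i j k : Fin n) :
    g.rhs j k * FreeAlgebra.ι K i - FreeAlgebra.ι K k * g.rhs i j =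
      g.ndc i j k + g.c j k • (FreeAlgebra.ι K j * g.relator i k)
        + (g.c j k * g.c i k) • (g.relator i j * FreeAlgebra.ι K k)
        - g.c i j • (g.relator i k * FreeAlgebra.ι K j)
        - (g.c i j * g.c i k) • (FreeAlgebra.ι K i * g.relator j k) := by
  simp only [relator, rhs, ndc, mul_add, add_mul, mul_sub, sub_mul, smul_sub, smul_add,
    mul_smul_comm, smul_mul_assoc, smul_smul, mul_assoc]
  module

variable (g m) in
/-- The normal form is compatible with all rewritings of words of rank less than `r`. -/
def KillsBelow (r : m.syn ×ₗ ℕ) : Prop :=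
  ∀ u j i v, i < j → rank m (u ++ j :: i :: v) < r →
    g.nf m (word K u * g.relator i j * word K v) = 0

lemma KillsBelow.relatorsLT {r : m.syn ×ₗ ℕ} (h : KillsBelow g m r) {D : m.syn}
    {f : FreeAlgebra K (Fin n)} (hf : f ∈ g.relatorsLT m D) (u v : List (Fin n))
    (hD : toLex (m.toSyn (mdeg u) + D + m.toSyn (mdeg v), 0) ≤ r) :
    g.nf m (word K u * f * word K v) = 0 := by
  have : GData.relatorsLT g m D ≤ LinearMap.ker ((g.nf m).comp (sandwich (word K u) (word K v))) := by
    refine Submodule.span_le.2 ?_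
    rintro _ ⟨u', j, i, v', hij, hlt, rfl⟩
    simp only [SetLike.mem_coe, LinearMap.mem_ker, LinearMap.comp_apply, sandwich_apply]
    have e : word K u * (word K u' * g.relator i j * word K v') * word K v =
        word K (u ++ u') * g.relator i j * word K (v' ++ v) := by
      simp only [word_append, mul_assoc]
    rw [e]
    -- The multidegree drops strictly, so the number of inversions is irrelevant; this is why `hD`
    -- may compare with inversion number `0`.
    refine h _ _ _ _ hij (lt_of_lt_of_le (Prod.Lex.toLex_lt_toLex.2 (Or.inl ?_)) hD)
    have := add_lt_add_left (add_lt_add_right hlt (m.toSyn (mdeg u))) (m.toSyn (mdeg v))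
    refine lt_of_eq_of_lt ?_ this
    simp only [mdeg_append, mdeg_cons, map_add]
    abel
  simpa using this hf

lemma relator_split (i j : Fin n) (u v : List (Fin n)) :
    word K u * g.relator i j * word K v =
      word K (u ++ j :: i :: v) - word K u * g.rhs i j * word K v := by
  rw [relator, mul_sub, sub_mul]
  simp [word, mul_assoc]

/-- Rewritings at disjoint descents lead to the same normal form. -/
lemma KillsBelow.disjoint (hg : g.Admissible m) {u v a : List (Fin n)} {j i l k : Fin n}
    (hij : i < j) (hkl : k < l)
    (h : KillsBelow g m (rank m (u ++ j :: i :: (a ++ l :: k :: v)))) :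
    g.nf m (word K u * g.rhs i j * word K (a ++ l :: k :: v)) =
      g.nf m (word K (u ++ j :: i :: a) * g.rhs k l * word K v) := by
  -- both sides agree with the result of rewriting both descents
  have h1 : g.nf m (word K u * g.rhs i j * word K (a ++ l :: k :: v)) =
      g.nf m (word K u * g.rhs i j * (word K a * g.rhs k l * word K v)) := by
    have aux : ∀ w : List (Fin n), rank m (u ++ w ++ (a ++ l :: k :: v)) <
        rank m (u ++ j :: i :: (a ++ l :: k :: v)) →
        g.nf m (word K u * word K w * word K (a ++ l :: k :: v)) =
          g.nf m (word K u * word K w * (word K a * g.rhs k l * word K v)) := by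
      intro w hw
      have := h (u ++ w ++ a) l k v hkl (by simpa using hw)
      rw [relator_split, map_sub, sub_eq_zero] at this
      simpa only [word_append, mul_assoc, List.append_assoc] using this
    have e1 := map_rhs (g := g) ((g.nf m).comp (sandwich (word K u)
      (word K (a ++ l :: k :: v)))) i j
    have e2 := map_rhs (g := g) ((g.nf m).comp (sandwich (word K u)
      (word K a * g.rhs k l * word K v))) i j
    simp only [LinearMap.comp_apply, sandwich_apply] at e1 e2
    rw [e1, e2, aux [i, j] (by simpa using rank_swap_lt m u _ hij)]
    congr 1
    refine Finset.sum_congr rfl fun α hα => ?_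
    dsimp only
    rw [aux _ (rank_lt_of_mdeg_lt m (rank_monWord_lt hg hij u _ hα))]
  have h2 : g.nf m (word K (u ++ j :: i :: a) * g.rhs k l * word K v) =
      g.nf m (word K u * g.rhs i j * word K a * g.rhs k l * word K v) := by
    have aux : ∀ w : List (Fin n), rank m (u ++ j :: i :: a ++ w ++ v) <
        rank m (u ++ j :: i :: (a ++ l :: k :: v)) →
        g.nf m (word K (u ++ j :: i :: a) * word K w * word K v) =
          g.nf m (word K u * g.rhs i j * word K a * word K w * word K v) := by
      intro w hw
      have := h u j i (a ++ w ++ v) hij (by simpa using hw)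
      rw [relator_split, map_sub, sub_eq_zero] at this
      simpa only [word_append, word_cons, mul_assoc, List.append_assoc] using this
    have e1 := map_rhs (g := g) ((g.nf m).comp (sandwich (word K (u ++ j :: i :: a))
      (word K v))) k l
    have e2 := map_rhs (g := g) ((g.nf m).comp (sandwich (word K u * g.rhs i j * word K a)
      (word K v))) k l
    simp only [LinearMap.comp_apply, sandwich_apply] at e1 e2
    rw [e1, e2, aux [k, l] (by simpa using rank_swap_lt m (u ++ j :: i :: a) v hkl)]
    congr 1
    refine Finset.sum_congr rfl fun α hα => ?_
    dsimp only
    rw [aux _ (rank_lt_of_mdeg_lt m (by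
      simpa using rank_monWord_lt hg hkl (u ++ j :: i :: a) v hα))]
  rw [h1, h2]
  simp only [mul_assoc]

/-- Rewritings at overlapping descents lead to the same normal form. -/
lemma KillsBelow.overlap (hg : g.IsGAlgebra m) {u v : List (Fin n)} {i j k : Fin n}
    (hij : i < j) (hjk : j < k) (h : KillsBelow g m (rank m (u ++ k :: j :: i :: v))) :
    g.nf m (word K u * g.rhs j k * word K (i :: v)) =
      g.nf m (word K (u ++ [k]) * g.rhs i j * word K v) := by
  have hik := hij.trans hjk
  -- `r1` to `r4` bound the words in which the four relators of `overlap_eq` are applied. Each is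
  -- reached from `k j i` by swapping descents.
  have r1 : rank m (u ++ j :: k :: i :: v) < rank m (u ++ k :: j :: i :: v) :=
    rank_swap_lt m u (i :: v) hjk
  have r2 : rank m (u ++ j :: i :: k :: v) < rank m (u ++ k :: j :: i :: v) :=
    lt_trans (by simpa using rank_swap_lt m (u ++ [j]) v hik) r1
  have r3 : rank m (u ++ k :: i :: j :: v) < rank m (u ++ k :: j :: i :: v) := by
    simpa using rank_swap_lt m (u ++ [k]) v hij
  have r4 : rank m (u ++ i :: k :: j :: v) < rank m (u ++ k :: j :: i :: v) :=
    lt_trans (rank_swap_lt m u (j :: v) hik) r3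
  have h0 := h.relatorsLT (mem_relatorsLT_of_reducesToZero hg.admissible
    (hg.nondegenerate i j k hij hjk) (ndc_mem_wordsLT hg.admissible hij hjk)) u v (by
      rw [rank, Prod.Lex.toLex_le_toLex]
      refine Or.inr ⟨?_, Nat.zero_le _⟩
      simp only [mdeg_append, mdeg_cons, mdeg_nil, map_add, map_zero]
      abel)
  have h1 := h (u ++ [j]) k i v hik (by simpa using r1)
  have h2 := h u j i (k :: v) hij r2
  have h3 := h u k i (j :: v) hik r3
  have h4 := h (u ++ [i]) k j v hjk (by simpa using r4)
  have e : word K u * g.rhs j k * word K (i :: v) - word K (u ++ [k]) * g.rhs i j * word K v =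
      sandwich (word K u) (word K v)
        (g.rhs j k * FreeAlgebra.ι K i - FreeAlgebra.ι K k * g.rhs i j) := by
    rw [map_sub]
    simp [word, mul_assoc]
  rw [← sub_eq_zero, ← map_sub, e, overlap_eq]
  simp only [map_add, map_sub, map_smul, sandwich_apply]
  simp only [word_append, word_cons, word_nil, mul_one, mul_assoc] at h0 h1 h2 h3 h4 ⊢
  rw [h0, h1, h2, h3, h4]
  simp

lemma KillsBelow.rhs_eq (hg : g.IsGAlgebra m) {w u₁ v₁ u₂ v₂ : List (Fin n)} {j₁ i₁ j₂ i₂ : Fin n}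
    (h : KillsBelow g m (rank m w)) (h₁ : i₁ < j₁) (h₂ : i₂ < j₂)
    (hw₁ : w = u₁ ++ j₁ :: i₁ :: v₁) (hw₂ : w = u₂ ++ j₂ :: i₂ :: v₂) :
    g.nf m (word K u₁ * g.rhs i₁ j₁ * word K v₁) =
      g.nf m (word K u₂ * g.rhs i₂ j₂ * word K v₂) := by
  have key : ∀ {a u₁ v₁ u₂ v₂ : List (Fin n)} {j₁ i₁ j₂ i₂ : Fin n} (_ : i₁ < j₁) (_ : i₂ < j₂)
      (_ : w = u₁ ++ j₁ :: i₁ :: v₁) (_ : u₂ = u₁ ++ a) (_ : j₁ :: i₁ :: v₁ = a ++ j₂ :: i₂ :: v₂),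
      g.nf m (word K u₁ * g.rhs i₁ j₁ * word K v₁) =
      g.nf m (word K u₂ * g.rhs i₂ j₂ * word K v₂) := by
    intro a u₁ v₁ u₂ v₂ j₁ i₁ j₂ i₂ h₁ h₂ hw hu ha
    -- `a` is the offset between the two descents: length 0 means the same descent, length 1 an
    -- overlap in one letter, length at least 2 disjoint descents.
    match a with
    | [] =>
      simp only [List.nil_append, List.cons.injEq] at ha
      obtain ⟨rfl, rfl, rfl⟩ := ha
      rw [hu, List.append_nil]
    | [x] =>
      simp only [List.cons_append, List.nil_append, List.cons.injEq] at ha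
      obtain ⟨rfl, rfl, rfl⟩ := ha
      subst hu
      exact KillsBelow.overlap hg h₂ h₁ (hw ▸ h)
    | x :: y :: b =>
      simp only [List.cons_append, List.cons.injEq] at ha
      obtain ⟨rfl, rfl, rfl⟩ := ha
      subst hu
      exact KillsBelow.disjoint hg.admissible h₁ h₂ (hw ▸ h)
  have hw := hw₁.symm.trans hw₂
  rcases List.append_eq_append_iff.1 hw with ⟨a, ha, hb⟩ | ⟨a, ha, hb⟩
  · exact key h₁ h₂ hw₁ ha hb
  · exact (key h₂ h₁ hw₂ ha hb).symm

/-- Well-founded induction on rank: the chosen descent of a word is compatible by construction, and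
every other descent gives the same value by `KillsBelow.rhs_eq`, which needs only words of smaller
rank. -/
lemma killsBelow (hg : g.IsGAlgebra m) (r : m.syn ×ₗ ℕ) : KillsBelow g m r := by
  induction r using WellFoundedLT.induction with
  | ind r ih =>
    intro u j i v hij hr
    obtain ⟨u', j', i', v', hij', hw, h0⟩ := exists_nf_descent (g := g) hg.admissible
      ⟨(u, j, i, v), hij, rfl⟩
    rw [relator_split, map_sub, sub_eq_zero] at h0 ⊢
    rw [KillsBelow.rhs_eq hg (ih _ hr) hij hij' rfl hw, ← h0, ← hw]

/-! ### Descent of the normal form to the quotient algebra. -/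

lemma nf_relator (hg : g.IsGAlgebra m) {i j : Fin n} (hij : i < j) (u v : List (Fin n)) :
    g.nf m (word K u * g.relator i j * word K v) = 0 :=
  killsBelow hg (toLex (m.toSyn (mdeg (u ++ j :: i :: v)), inv (u ++ j :: i :: v) + 1)) u j i v hij
    (Prod.Lex.toLex_lt_toLex.2 (Or.inr ⟨rfl, Nat.lt_succ_self _⟩))

variable (K n) in
lemma span_word : Submodule.span K (Set.range (word K (n := n))) = ⊤ := by
  rw [← (FreeAlgebra.basisFreeMonoid K (Fin n)).span_eq]
  congr 1
  ext x
  exact ⟨fun ⟨w, hw⟩ => ⟨FreeMonoid.ofList w, (basisFreeMonoid_apply w).trans hw⟩,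
    fun ⟨w, hw⟩ => ⟨w.toList, (basisFreeMonoid_apply w.toList).symm.trans hw⟩⟩

lemma nf_mul_relator_mul (hg : g.IsGAlgebra m) {i j : Fin n} (hij : i < j)
    (a b : FreeAlgebra K (Fin n)) : g.nf m (a * g.relator i j * b) = 0 := by
  have ha : a ∈ Submodule.span K (Set.range (word K (n := n))) :=
    span_word K n ▸ Submodule.mem_top
  have hb : b ∈ Submodule.span K (Set.range (word K (n := n))) :=
    span_word K n ▸ Submodule.mem_top
  induction ha using Submodule.span_induction with
  | zero => simp
  | add x y _ _ hx hy => rw [add_mul, add_mul, map_add, hx, hy, add_zero]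
  | smul c x _ hx => rw [smul_mul_assoc, smul_mul_assoc, map_smul, hx, smul_zero]
  | mem x hx =>
    obtain ⟨u, rfl⟩ := hx
    induction hb using Submodule.span_induction with
    | zero => simp
    | add x y _ _ hx hy => rw [mul_add, map_add, hx, hy, add_zero]
    | smul c x _ hx => rw [mul_smul_comm, map_smul, hx, smul_zero]
    | mem x hx =>
      obtain ⟨v, rfl⟩ := hx
      exact nf_relator hg hij u v

/-- The arbitrary outer factors `a` and `b` absorb the multiplications by which `RingQuot.Rel`
closes up the relations. -/
lemma nf_eq_of_rel (hg : g.IsGAlgebra m) {x y : FreeAlgebra K (Fin n)}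
    (h : RingQuot.Rel g.Rel x y) (a b : FreeAlgebra K (Fin n)) :
    g.nf m (a * x * b) = g.nf m (a * y * b) := by
  induction h generalizing a b with
  | of h =>
    obtain ⟨i, j, hij⟩ := h
    rw [← sub_eq_zero, ← map_sub, ← sub_mul, ← mul_sub]
    exact nf_mul_relator_mul hg hij a b
  | add_left _ ih => simp only [mul_add, add_mul, map_add, ih]
  | @mul_left x y c _ ih =>
    have := ih a (c * b)
    simpa only [mul_assoc] using this
  | @mul_right c x y _ ih =>
    have := ih (a * c) b
    simpa only [mul_assoc] using this

lemma nf_eq_of_proj_eq (hg : g.IsGAlgebra m) {x y : FreeAlgebra K (Fin n)}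
    (h : g.proj x = g.proj y) : g.nf m x = g.nf m y := by
  have h' : RingQuot.mkRingHom g.Rel x = RingQuot.mkRingHom g.Rel y := by
    rw [← RingQuot.mkAlgHom_coe K]; exact h
  -- Mapping on to the quotient by the ring congruence turns equality in `RingQuot` into a chain of
  -- `RingQuot.Rel` steps, on which induction is possible.
  have hlift : ∀ ⦃x y⦄, g.Rel x y →
      (RingQuot.ringCon g.Rel).mk' x = (RingQuot.ringCon g.Rel).mk' y :=
    fun x y hxy => (RingCon.eq _).2 (Relation.EqvGen.rel _ _ (RingQuot.Rel.of hxy))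
  have h2 := congrArg (RingQuot.lift ⟨(RingQuot.ringCon g.Rel).mk', hlift⟩) h'
  rw [RingQuot.lift_mkRingHom_apply, RingQuot.lift_mkRingHom_apply] at h2
  have h3 : Relation.EqvGen (RingQuot.Rel g.Rel) x y := (RingCon.eq _).1 h2
  clear h h' h2
  induction h3 with
  | rel x y h => simpa using nf_eq_of_rel hg h 1 1
  | refl => rfl
  | symm x y _ ih => exact ih.symm
  | trans x y z _ _ ih₁ ih₂ => exact ih₁.trans ih₂

/-! ## The basis of standard monomials -/

lemma proj_relator {i j : Fin n} (hij : i < j) : g.proj (g.relator i j) = 0 := by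
  rw [relator, map_sub, sub_eq_zero]
  exact RingQuot.mkAlgHom_rel K (Rel.mk i j hij)

variable (g) in
/-- `ofCoeffs` as a linear map. -/
noncomputable def ofCoeffsLinear : ((Fin n →₀ ℕ) →₀ K) →ₗ[K] g.Alg :=
  g.proj.toLinearMap.comp (Finsupp.linearCombination K (freeMon K))

lemma ofCoeffsLinear_apply (p : (Fin n →₀ ℕ) →₀ K) : g.ofCoeffsLinear p = g.ofCoeffs p := rfl

lemma nf_word_of_pairwise {w : List (Fin n)} (hw : w.Pairwise (· ≤ ·)) :
    g.nf m (word K w) = Finsupp.single (mdeg w) 1 := by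
  rw [nf_word, nfWord_of_pairwise hw]

lemma nf_freePoly (p : (Fin n →₀ ℕ) →₀ K) : g.nf m (freePoly p) = p := by
  conv_rhs => rw [← Finsupp.sum_single p]
  rw [freePoly, map_finsuppSum]
  refine Finset.sum_congr rfl fun α _ => ?_
  dsimp only
  rw [map_smul, ← word_monWord, nf_word_of_pairwise (pairwise_monWord α), mdeg_monWord]
  simp

/-- Induction on words along rewriting. -/
lemma word_induction (hg : g.IsGAlgebra m) {P : List (Fin n) → Prop}
    (sorted : ∀ w, w.Pairwise (· ≤ ·) → P w)
    (descent : ∀ u j i v, i < j → P (u ++ i :: j :: v) →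
      (∀ α ∈ (g.d i j).support, P (u ++ monWord α ++ v)) → P (u ++ j :: i :: v))
    (w : List (Fin n)) : P w := by
  induction w using (InvImage.wf (rank m) wellFounded_lt).induction with
  | h w ih =>
    by_cases h : ∃ d, IsDescent w d
    · obtain ⟨⟨u, j, i, v⟩, hij, rfl⟩ := h
      exact descent u j i v hij (ih _ (rank_swap_lt m u v hij)) fun α hα =>
        ih _ (rank_lt_of_mdeg_lt m (rank_monWord_lt hg.admissible hij u v hα))
    · exact sorted w (pairwise_of_forall_not_isDescent h)

lemma map_word_descent {V : Type*} [AddCommGroup V] [Module K V]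
    (L : FreeAlgebra K (Fin n) →ₗ[K] V) (u v : List (Fin n)) {i j : Fin n}
    (hL : L (word K u * g.relator i j * word K v) = 0) :
    L (word K (u ++ j :: i :: v)) = g.c i j • L (word K (u ++ i :: j :: v)) +
      (g.d i j).sum fun α a => a • L (word K (u ++ monWord α ++ v)) := by
  rw [relator_split, map_sub, sub_eq_zero] at hL
  have e := map_rhs (g := g) (L.comp (sandwich (word K u) (word K v))) i j
  simp only [LinearMap.comp_apply, sandwich_apply, ← word_append] at e
  rw [hL, e, List.append_assoc, List.cons_append, List.cons_append, List.nil_append]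

/-- Both sides kill the relators, so they satisfy the same recursion along descents, and they agree
on sorted words. -/
lemma proj_word (hg : g.IsGAlgebra m) (w : List (Fin n)) :
    g.proj (word K w) = g.ofCoeffsLinear (g.nf m (word K w)) := by
  induction w using word_induction hg with
  | sorted w hw =>
    rw [nf_word_of_pairwise hw, ofCoeffsLinear_apply, ofCoeffs, freePoly,
      Finsupp.sum_single_index (by simp), one_smul, ← word_monWord, ← eq_monWord_of_pairwise hw]
  | descent u j i v hij h1 h2 =>
    have e1 := map_word_descent (g := g) g.proj.toLinearMap u v (i := i) (j := j)
      (by simp [proj_relator hij])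
    have e2 := map_word_descent (g.ofCoeffsLinear.comp (g.nf m)) u v (i := i) (j := j)
      (by rw [LinearMap.comp_apply, nf_relator hg hij, map_zero])
    simp only [LinearMap.comp_apply, AlgHom.toLinearMap_apply] at e1 e2
    rw [e1, e2, h1]
    congr 1
    refine Finset.sum_congr rfl fun α hα => ?_
    dsimp only
    rw [h2 α hα]

lemma proj_eq (hg : g.IsGAlgebra m) (f : FreeAlgebra K (Fin n)) :
    g.proj f = g.ofCoeffs (g.nf m f) := by
  have : g.proj.toLinearMap = g.ofCoeffsLinear.comp (g.nf m) := by
    refine LinearMap.ext_on (span_word K n) ?_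
    rintro _ ⟨w, rfl⟩
    exact proj_word hg w
  exact LinearMap.congr_fun this f

/-- The normal form is a left inverse, and `proj_eq` gives surjectivity. Only from here on is
`coeffs`, defined through `Function.invFun`, a true inverse. -/
lemma ofCoeffs_bijective (hg : g.IsGAlgebra m) : Function.Bijective g.ofCoeffs := by
  constructor
  · intro p q h
    have := nf_eq_of_proj_eq hg h
    rwa [nf_freePoly, nf_freePoly] at this
  · intro f
    obtain ⟨f, rfl⟩ := RingQuot.mkAlgHom_surjective K g.Rel f
    exact ⟨_, (proj_eq hg f).symm⟩

lemma coeffs_ofCoeffs (hg : g.IsGAlgebra m) (p : (Fin n →₀ ℕ) →₀ K) :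
    g.coeffs (g.ofCoeffs p) = p :=
  Function.leftInverse_invFun (ofCoeffs_bijective hg).1 p

lemma ofCoeffs_coeffs (hg : g.IsGAlgebra m) (f : g.Alg) : g.ofCoeffs (g.coeffs f) = f :=
  Function.rightInverse_invFun (ofCoeffs_bijective hg).2 f

lemma coeffs_proj (hg : g.IsGAlgebra m) (f : FreeAlgebra K (Fin n)) :
    g.coeffs (g.proj f) = g.nf m f := by
  rw [proj_eq hg, coeffs_ofCoeffs hg]

/-- The coefficients with respect to the standard monomials, as a linear equivalence. -/
noncomputable def coeffsEquiv (hg : g.IsGAlgebra m) : g.Alg ≃ₗ[K] ((Fin n →₀ ℕ) →₀ K) :=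
  LinearEquiv.symm
    { g.ofCoeffsLinear with
      invFun := g.coeffs
      left_inv := coeffs_ofCoeffs hg
      right_inv := ofCoeffs_coeffs hg }

@[simp] lemma coeffsEquiv_apply (hg : g.IsGAlgebra m) (f : g.Alg) :
    coeffsEquiv hg f = g.coeffs f := rfl

lemma nf_word_le (hg : g.IsGAlgebra m) (w : List (Fin n)) {α : Fin n →₀ ℕ}
    (h : g.nf m (word K w) α ≠ 0) : m.toSyn α ≤ m.toSyn (mdeg w) := by
  induction w using word_induction hg with
  | sorted w hw =>
    rw [nf_word_of_pairwise hw, Finsupp.single_apply] at h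
    simp only [ne_eq, ite_eq_right_iff, one_ne_zero, imp_false, not_not] at h
    rw [h]
  | descent u j i v hij h1 h2 =>
    rw [map_word_descent (g.nf m) u v (nf_relator hg hij u v), Finsupp.add_apply,
      Finsupp.smul_apply] at h
    by_cases hc : g.nf m (word K (u ++ i :: j :: v)) α = 0
    · rw [hc, smul_zero, zero_add, Finsupp.sum, Finsupp.finsetSum_apply] at h
      obtain ⟨β, hβ, hne⟩ := Finset.exists_ne_zero_of_sum_ne_zero h
      exact (h2 β hβ (right_ne_zero_of_smul hne)).trans
        (rank_monWord_lt hg.admissible hij u v hβ).le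
    · refine (h1 hc).trans (le_of_eq ?_)
      simp [add_left_comm]

/-- At the top multidegree a rewriting merely multiplies the coefficient by `c_ij ≠ 0`, since the
words from `d_ij` lie strictly below. -/
lemma nf_word_mdeg_ne_zero (hg : g.IsGAlgebra m) (w : List (Fin n)) :
    g.nf m (word K w) (mdeg w) ≠ 0 := by
  induction w using word_induction hg with
  | sorted w hw => simp [nf_word_of_pairwise hw]
  | descent u j i v hij h1 _ =>
    have e : mdeg (u ++ i :: j :: v) = mdeg (u ++ j :: i :: v) := by simp [add_left_comm]
    have h0 : ((g.d i j).sum fun α a => a • g.nf m (word K (u ++ monWord α ++ v)))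
        (mdeg (u ++ j :: i :: v)) = 0 := by
      rw [Finsupp.sum, Finsupp.finsetSum_apply]
      refine Finset.sum_eq_zero fun α hα => ?_
      rw [Finsupp.smul_apply]
      by_contra hne
      exact absurd (nf_word_le hg _ (right_ne_zero_of_smul hne))
        (not_le.2 (rank_monWord_lt hg.admissible hij u v hα))
    rw [map_word_descent (g.nf m) u v (nf_relator hg hij u v), Finsupp.add_apply, h0, add_zero,
      Finsupp.smul_apply, ← e]
    exact smul_ne_zero (hg.c_ne_zero i j hij) h1

end GData

/-! ## Leading exponents -/

namespace GData

variable {K : Type*} [Field K] {n : ℕ} {g : GData K n} {m : MonomialOrder (Fin n)}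

variable (g) in
/-- The standard monomial with exponent `α`. -/
noncomputable def mon (α : Fin n →₀ ℕ) : g.Alg := g.proj (freeMon K α)

lemma coeffs_zero (hg : g.IsGAlgebra m) : g.coeffs 0 = 0 := map_zero (coeffsEquiv hg)

lemma coeffs_add (hg : g.IsGAlgebra m) (f h : g.Alg) :
    g.coeffs (f + h) = g.coeffs f + g.coeffs h := map_add (coeffsEquiv hg) f h

lemma coeffs_sub (hg : g.IsGAlgebra m) (f h : g.Alg) :
    g.coeffs (f - h) = g.coeffs f - g.coeffs h := map_sub (coeffsEquiv hg) f h

lemma coeffs_smul (hg : g.IsGAlgebra m) (a : K) (f : g.Alg) :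
    g.coeffs (a • f) = a • g.coeffs f := map_smul (coeffsEquiv hg) a f

lemma coeffs_sum (hg : g.IsGAlgebra m) {ι : Type*} (s : Finset ι) (f : ι → g.Alg) :
    g.coeffs (∑ i ∈ s, f i) = ∑ i ∈ s, g.coeffs (f i) := map_sum (coeffsEquiv hg) f s

lemma coeffs_eq_zero (hg : g.IsGAlgebra m) {f : g.Alg} : g.coeffs f = 0 ↔ f = 0 :=
  (coeffsEquiv hg).map_eq_zero_iff

lemma coeffs_mon (hg : g.IsGAlgebra m) (α : Fin n →₀ ℕ) :
    g.coeffs (g.mon α) = Finsupp.single α 1 := by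
  rw [mon, coeffs_proj hg, ← word_monWord, nf_word_of_pairwise (pairwise_monWord α), mdeg_monWord]

lemma sum_coeffs_smul_mon (hg : g.IsGAlgebra m) (f : g.Alg) :
    ∑ α ∈ (g.coeffs f).support, g.coeffs f α • g.mon α = f := by
  conv_rhs => rw [← ofCoeffs_coeffs hg f]
  rw [ofCoeffs, freePoly, Finsupp.sum, map_sum]
  simp [mon]

lemma coeffs_mon_mul_mon (hg : g.IsGAlgebra m) (α β : Fin n →₀ ℕ) :
    g.coeffs (g.mon α * g.mon β) = g.nf m (word K (monWord α ++ monWord β)) := by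
  rw [mon, mon, ← map_mul, coeffs_proj hg, word_append, word_monWord, word_monWord]

lemma coeffs_mon_mul_mon_le (hg : g.IsGAlgebra m) {α β γ : Fin n →₀ ℕ}
    (h : g.coeffs (g.mon α * g.mon β) γ ≠ 0) : m.toSyn γ ≤ m.toSyn (α + β) := by
  rw [coeffs_mon_mul_mon hg] at h
  simpa [mdeg_monWord] using nf_word_le hg _ h

lemma coeffs_mon_mul_mon_add_ne_zero (hg : g.IsGAlgebra m) (α β : Fin n →₀ ℕ) :
    g.coeffs (g.mon α * g.mon β) (α + β) ≠ 0 := by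
  rw [coeffs_mon_mul_mon hg]
  simpa [mdeg_monWord] using nf_word_mdeg_ne_zero hg (monWord α ++ monWord β)

lemma coeffs_mul (hg : g.IsGAlgebra m) (f h : g.Alg) (γ : Fin n →₀ ℕ) :
    g.coeffs (f * h) γ = ∑ q ∈ (g.coeffs f).support ×ˢ (g.coeffs h).support,
      g.coeffs f q.1 * g.coeffs h q.2 * g.coeffs (g.mon q.1 * g.mon q.2) γ := by
  conv_lhs => rw [← sum_coeffs_smul_mon hg f, ← sum_coeffs_smul_mon hg h]
  rw [Finset.sum_mul_sum, ← Finset.sum_product', coeffs_sum hg, Finsupp.finsetSum_apply]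
  refine Finset.sum_congr rfl fun q _ => ?_
  rw [smul_mul_smul_comm, coeffs_smul hg, Finsupp.smul_apply, smul_eq_mul]

lemma exists_of_coeffs_mul_ne_zero (hg : g.IsGAlgebra m) {f h : g.Alg} {γ : Fin n →₀ ℕ}
    (hγ : g.coeffs (f * h) γ ≠ 0) : ∃ α β, g.coeffs f α ≠ 0 ∧ g.coeffs h β ≠ 0 ∧
      m.toSyn γ ≤ m.toSyn (α + β) := by
  rw [coeffs_mul hg] at hγ
  obtain ⟨q, hq, hne⟩ := Finset.exists_ne_zero_of_sum_ne_zero hγ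
  rw [Finset.mem_product, Finsupp.mem_support_iff, Finsupp.mem_support_iff] at hq
  exact ⟨q.1, q.2, hq.1, hq.2, coeffs_mon_mul_mon_le hg (right_ne_zero_of_mul hne)⟩

variable (g m) in
/-- `α` is the leading exponent of `f`. -/
def IsLead (f : g.Alg) (α : Fin n →₀ ℕ) : Prop :=
  g.coeffs f α ≠ 0 ∧ ∀ β, g.coeffs f β ≠ 0 → m.toSyn β ≤ m.toSyn α

lemma exists_isLead (hg : g.IsGAlgebra m) {f : g.Alg} (hf : f ≠ 0) : ∃ α, g.IsLead m f α := by
  have : (g.coeffs f).support.Nonempty :=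
    Finsupp.support_nonempty_iff.2 (mt (coeffs_eq_zero hg).1 hf)
  obtain ⟨α, hα, hmax⟩ := Finset.exists_max_image _ m.toSyn this
  exact ⟨α, Finsupp.mem_support_iff.1 hα, fun β hβ => hmax β (Finsupp.mem_support_iff.2 hβ)⟩

/-- The order is strictly compatible with addition, so among all pairs of exponents only `(α, β)`
can contribute to `α + β`. -/
lemma IsLead.mul (hg : g.IsGAlgebra m) {f h : g.Alg} {α β : Fin n →₀ ℕ} (hf : g.IsLead m f α)
    (hh : g.IsLead m h β) : g.IsLead m (f * h) (α + β) := by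
  constructor
  · rw [coeffs_mul hg, Finset.sum_eq_single (α, β)]
    · exact mul_ne_zero (mul_ne_zero hf.1 hh.1) (coeffs_mon_mul_mon_add_ne_zero hg α β)
    · rintro ⟨α', β'⟩ hq hne
      rw [Finset.mem_product, Finsupp.mem_support_iff, Finsupp.mem_support_iff] at hq
      by_contra h0
      have h1 := coeffs_mon_mul_mon_le hg (right_ne_zero_of_mul h0)
      have h2 := hf.2 α' hq.1
      have h3 := hh.2 β' hq.2
      simp only [map_add] at h1
      have h4 : m.toSyn α' = m.toSyn α :=
        le_antisymm h2 (le_of_not_gt fun hlt => absurd h1 (not_le.2 (add_lt_add_of_lt_of_le hlt h3)))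
      have h5 : m.toSyn β' = m.toSyn β :=
        le_antisymm h3 (le_of_not_gt fun hlt => absurd h1 (not_le.2 (add_lt_add_of_le_of_lt h2 hlt)))
      exact hne (Prod.ext (m.toSyn.injective h4) (m.toSyn.injective h5))
    · intro hq
      rw [Finset.mem_product, Finsupp.mem_support_iff, Finsupp.mem_support_iff] at hq
      exact absurd ⟨hf.1, hh.1⟩ hq
  · intro γ hγ
    obtain ⟨α', β', h1, h2, h3⟩ := exists_of_coeffs_mul_ne_zero hg hγ
    refine h3.trans ?_
    rw [map_add, map_add]
    exact add_le_add (hf.2 α' h1) (hh.2 β' h2)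

lemma IsLead.ne_zero (hg : g.IsGAlgebra m) {f : g.Alg} {α : Fin n →₀ ℕ} (h : g.IsLead m f α) :
    f ≠ 0 := by
  rintro rfl
  exact h.1 (by rw [coeffs_zero hg]; rfl)

lemma mul_ne_zero_alg (hg : g.IsGAlgebra m) {f h : g.Alg} (hf : f ≠ 0) (hh : h ≠ 0) :
    f * h ≠ 0 := by
  obtain ⟨α, hα⟩ := exists_isLead hg hf
  obtain ⟨β, hβ⟩ := exists_isLead hg hh
  exact (hα.mul hg hβ).ne_zero hg

end GData

/-! ## The degree in the last variable -/

namespace GData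

variable {K : Type*} [Field K] {n : ℕ} {g : GData K (n + 1)} {m : MonomialOrder (Fin (n + 1))}

lemma LastDominates.lt_of_last_lt (hm : LastDominates m) {α β : Fin (n + 1) →₀ ℕ}
    (h : α (Fin.last n) < β (Fin.last n)) : m.toSyn α < m.toSyn β := by
  have h1 := hm (α.erase (Fin.last n)) (by simp)
  -- With `a` the exponent of `∂` in `α`, the remaining factor is below `∂`, so `α` is below `∂ ^ (a
  -- + 1)`, which divides `β`.
  have h2 : Finsupp.single (Fin.last n) (α (Fin.last n)) + Finsupp.single (Fin.last n) 1 ≤ β := by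
    rw [← Finsupp.single_add, Finsupp.single_le_iff]
    exact h
  calc m.toSyn α = m.toSyn (Finsupp.single (Fin.last n) (α (Fin.last n))) +
        m.toSyn (α.erase (Fin.last n)) := by
        rw [← map_add, Finsupp.single_add_erase]
    _ < _ := add_lt_add_right h1 _
    _ ≤ m.toSyn β := by rw [← map_add]; exact m.toSyn_monotone h2

lemma LastDominates.last_le (hm : LastDominates m) {α β : Fin (n + 1) →₀ ℕ}
    (h : m.toSyn α ≤ m.toSyn β) : α (Fin.last n) ≤ β (Fin.last n) :=
  le_of_not_gt fun hlt => absurd h (not_le.2 (hm.lt_of_last_lt hlt))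

/-- The degree in the last variable (with value `0` at `0`). -/
noncomputable def ddeg (f : g.Alg) : ℕ := (g.coeffs f).support.sup fun α => α (Fin.last n)

lemma IsLead.ddeg_eq (hm : LastDominates m) {f : g.Alg} {α : Fin (n + 1) →₀ ℕ}
    (h : g.IsLead m f α) : ddeg f = α (Fin.last n) := by
  refine le_antisymm (Finset.sup_le fun β hβ => hm.last_le (h.2 β (Finsupp.mem_support_iff.1 hβ))) ?_
  exact Finset.le_sup (f := fun α : Fin (n + 1) →₀ ℕ => α (Fin.last n))
    (Finsupp.mem_support_iff.2 h.1)

lemma le_ddeg {f : g.Alg} {α : Fin (n + 1) →₀ ℕ} (h : g.coeffs f α ≠ 0) :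
    α (Fin.last n) ≤ ddeg f :=
  Finset.le_sup (f := fun α : Fin (n + 1) →₀ ℕ => α (Fin.last n)) (Finsupp.mem_support_iff.2 h)

lemma ddeg_mul (hg : g.IsGAlgebra m) (hm : LastDominates m) {f h : g.Alg} (hf : f ≠ 0)
    (hh : h ≠ 0) : ddeg (f * h) = ddeg f + ddeg h := by
  obtain ⟨α, hα⟩ := exists_isLead hg hf
  obtain ⟨β, hβ⟩ := exists_isLead hg hh
  rw [(hα.mul hg hβ).ddeg_eq hm, hα.ddeg_eq hm, hβ.ddeg_eq hm, Finsupp.add_apply]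

/-- The elements of degree less than `d` in the last variable. -/
def degLT (hg : g.IsGAlgebra m) (d : ℕ) : Submodule K g.Alg where
  carrier := {f | ∀ α, g.coeffs f α ≠ 0 → α (Fin.last n) < d}
  zero_mem' := by
    intro α h
    rw [coeffs_zero hg] at h
    exact absurd rfl h
  add_mem' := by
    intro f h hf hh α hα
    rw [coeffs_add hg, Finsupp.add_apply] at hα
    by_cases h0 : g.coeffs f α = 0
    · exact hh α (by simpa [h0] using hα)
    · exact hf α h0
  smul_mem' := by
    intro a f hf α hα
    rw [coeffs_smul hg, Finsupp.smul_apply] at hα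
    exact hf α (right_ne_zero_of_smul hα)

lemma mem_degLT (hg : g.IsGAlgebra m) {d : ℕ} {f : g.Alg} :
    f ∈ degLT hg d ↔ ∀ α, g.coeffs f α ≠ 0 → α (Fin.last n) < d := Iff.rfl

lemma mem_degLT_succ (hg : g.IsGAlgebra m) {d : ℕ} {f : g.Alg} :
    f ∈ degLT hg (d + 1) ↔ ddeg f ≤ d :=
  ⟨fun h => Finset.sup_le fun α hα => Nat.lt_succ_iff.1 (h α (Finsupp.mem_support_iff.1 hα)),
    fun h _ hα => Nat.lt_succ_iff.2 ((le_ddeg hα).trans h)⟩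

lemma mem_degLT_iff (hg : g.IsGAlgebra m) {d : ℕ} {f : g.Alg} :
    f ∈ degLT hg d ↔ f = 0 ∨ ddeg f < d := by
  cases d with
  | zero =>
    rw [mem_degLT, ← coeffs_eq_zero hg, Finsupp.ext_iff]
    simp [not_not]
  | succ d =>
    rw [mem_degLT_succ, Nat.lt_succ_iff]
    refine ⟨Or.inr, ?_⟩
    rintro (rfl | h)
    · simp [ddeg, coeffs_zero hg]
    · exact h

/-- The bounds are asymmetric, degree at most `d` against degree below `e`, so that `d = 0` says
that left multiplication by `A_*` preserves `degLT hg e`, including `e = 0`. -/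
lemma mul_mem_degLT (hg : g.IsGAlgebra m) (hm : LastDominates m) {d e : ℕ} {f h : g.Alg}
    (hf : f ∈ degLT hg (d + 1)) (hh : h ∈ degLT hg e) : f * h ∈ degLT hg (d + e) := by
  intro γ hγ
  obtain ⟨α, β, h1, h2, h3⟩ := exists_of_coeffs_mul_ne_zero hg hγ
  have := hm.last_le h3
  have h4 := hf α h1
  have h5 := hh β h2
  rw [Finsupp.add_apply] at this
  omega

lemma mon_mem_degLT (hg : g.IsGAlgebra m) {d : ℕ} {α : Fin (n + 1) →₀ ℕ}
    (h : α (Fin.last n) < d) : g.mon α ∈ degLT hg d := by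
  intro β hβ
  rw [coeffs_mon hg, Finsupp.single_apply] at hβ
  split_ifs at hβ with he
  · exact he ▸ h
  · exact absurd rfl hβ

lemma mon_eq_mul_pow (α : Fin (n + 1) →₀ ℕ) :
    g.mon α = g.mon (α.erase (Fin.last n)) * g.gen (Fin.last n) ^ α (Fin.last n) := by
  have h : ∀ i : Fin n, (α.erase (Fin.last n)) i.castSucc = α i.castSucc :=
    fun i => Finsupp.erase_ne (Fin.castSucc_lt_last i).ne
  simp only [mon, freeMon, gen, ← map_pow, ← map_mul]
  rw [List.ofFn_succ', List.ofFn_succ']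
  simp [h]

lemma gen_pow_eq_mon (d : ℕ) :
    g.gen (Fin.last n) ^ d = g.mon (Finsupp.single (Fin.last n) d) := by
  rw [mon_eq_mul_pow]
  simp [mon, freeMon, List.ofFn_const]

lemma gen_eq_mon (i : Fin (n + 1)) : g.gen i = g.mon (Finsupp.single i 1) := by
  have : monWord (Finsupp.single i 1) = [i] := by
    have := eq_monWord_of_pairwise (w := [i]) (by simp)
    simpa using this.symm
  rw [mon, ← word_monWord, this, gen]
  simp [word]

/-- Multiplication cannot create `∂`: monomials of a product are bounded by sums of exponents, and
`∂` dominates everything free of it. -/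
lemma mem_Astar_iff (hg : g.IsGAlgebra m) (hm : LastDominates m) {f : g.Alg} :
    f ∈ g.Astar ↔ f ∈ degLT hg 1 := by
  constructor
  · intro hf
    induction hf using Algebra.adjoin_induction with
    | mem x hx =>
      obtain ⟨i, rfl⟩ := hx
      dsimp only
      rw [gen_eq_mon]
      exact mon_mem_degLT hg (by
        rw [Finsupp.single_eq_of_ne (Fin.castSucc_lt_last i).ne']; exact Nat.one_pos)
    | algebraMap r =>
      rw [Algebra.algebraMap_eq_smul_one]
      refine Submodule.smul_mem _ _ ?_
      have : (1 : g.Alg) = g.mon 0 := by simp [mon, freeMon, List.ofFn_const]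
      rw [this]
      exact mon_mem_degLT hg (by simp)
    | add x y _ _ hx hy => exact Submodule.add_mem _ hx hy
    | mul x y _ _ hx hy => exact mul_mem_degLT hg hm (d := 0) hx hy
  · intro hf
    rw [← sum_coeffs_smul_mon hg f]
    refine Subalgebra.sum_mem _ fun α hα => Subalgebra.smul_mem _ ?_ _
    have h0 : α (Fin.last n) = 0 := Nat.lt_one_iff.1 (hf α (Finsupp.mem_support_iff.1 hα))
    rw [mon, freeMon, map_list_prod, List.map_ofFn]
    refine Subalgebra.list_prod_mem _ fun x hx => ?_
    obtain ⟨i, rfl⟩ := (List.mem_ofFn' _ _).1 hx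
    rw [Function.comp_apply, map_pow]
    cases i using Fin.lastCases with
    | last => rw [h0, pow_zero]; exact Subalgebra.one_mem _
    | cast i => exact Subalgebra.pow_mem _ (Algebra.subset_adjoin (Set.mem_range_self i)) _

lemma ddeg_eq_zero_of_mem_Astar (hg : g.IsGAlgebra m) (hm : LastDominates m) {f : g.Alg}
    (hf : f ∈ g.Astar) : ddeg f = 0 :=
  Nat.le_zero.1 ((mem_degLT_succ hg).1 ((mem_Astar_iff hg hm).1 hf))

lemma mem_Astar_of_ddeg_eq_zero (hg : g.IsGAlgebra m) (hm : LastDominates m) {f : g.Alg}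
    (hf : ddeg f = 0) : f ∈ g.Astar :=
  (mem_Astar_iff hg hm).2 ((mem_degLT_succ hg).2 hf.le)

/-- The leading coefficient with respect to the last variable. -/
lemma exists_sub_mul_pow_mem_degLT (hg : g.IsGAlgebra m) (hm : LastDominates m) {d : ℕ}
    {f : g.Alg} (hf : f ∈ degLT hg (d + 1)) :
    ∃ a ∈ g.Astar, f - a * g.gen (Fin.last n) ^ d ∈ degLT hg d := by
  have key : ∀ α ∈ (g.coeffs f).support, ∃ a ∈ g.Astar,
      g.mon α - a * g.gen (Fin.last n) ^ d ∈ degLT hg d := by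
    intro α hα
    rcases (Nat.lt_succ_iff.1 (hf α (Finsupp.mem_support_iff.1 hα))).lt_or_eq with h | h
    · exact ⟨0, Subalgebra.zero_mem _, by simpa using mon_mem_degLT hg h⟩
    · refine ⟨g.mon (α.erase (Fin.last n)),
        (mem_Astar_iff hg hm).2 (mon_mem_degLT hg (by simp)), ?_⟩
      rw [mon_eq_mul_pow α, h, sub_self]
      exact Submodule.zero_mem _
  choose! a ha ha' using key
  refine ⟨∑ α ∈ (g.coeffs f).support, g.coeffs f α • a α,
    Subalgebra.sum_mem _ fun α hα => Subalgebra.smul_mem _ (ha α hα) _, ?_⟩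
  have e : f - (∑ α ∈ (g.coeffs f).support, g.coeffs f α • a α) * g.gen (Fin.last n) ^ d =
      ∑ α ∈ (g.coeffs f).support,
        g.coeffs f α • (g.mon α - a α * g.gen (Fin.last n) ^ d) := by
    simp only [smul_sub, Finset.sum_sub_distrib, sum_coeffs_smul_mon hg, Finset.sum_mul,
      smul_mul_assoc]
  rw [e]
  exact Submodule.sum_mem _ fun α hα => Submodule.smul_mem _ _ (ha' α hα)

end GData

/-! ## The Ore localization is a left principal ideal domain -/

namespace GData

variable {K : Type*} [Field K] {n : ℕ} {g : GData K (n + 1)} {m : MonomialOrder (Fin (n + 1))}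
  {R : Type*} [Ring R] {j : g.Alg →+* R}

lemma IsOreLocalizedAt.map_ne_zero (hj : g.IsOreLocalizedAt j) {f : g.Alg} (hf : f ≠ 0) :
    j f ≠ 0 := (map_ne_zero_iff j hj.injective).2 hf

/-- The left Ore condition for `A_* ∖ {0}` in the G-algebra. -/
lemma IsOreLocalizedAt.ore (hj : g.IsOreLocalizedAt j) (f : g.Alg) {s : g.Alg} (hs : s ∈ g.Astar)
    (hs0 : s ≠ 0) : ∃ t ∈ g.Astar, t ≠ 0 ∧ ∃ f', t * f = f' * s := by
  obtain ⟨u, hu⟩ := hj.isUnit s hs hs0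
  -- The right fraction `f s⁻¹` of `R` is rewritten as a left fraction `t⁻¹ f'`.
  obtain ⟨t, ht, ht0, f', h⟩ := hj.fraction (j f * ↑u⁻¹)
  refine ⟨t, ht, ht0, f', hj.injective ?_⟩
  rw [map_mul, map_mul, ← h, ← hu]
  simp [mul_assoc]

lemma IsOreLocalizedAt.ore_Astar (hg : g.IsGAlgebra m) (hm : LastDominates m)
    (hj : g.IsOreLocalizedAt j) {a b : g.Alg} (ha : a ∈ g.Astar) (ha0 : a ≠ 0) (hb : b ∈ g.Astar)
    (hb0 : b ≠ 0) : ∃ s ∈ g.Astar, s ≠ 0 ∧ ∃ t ∈ g.Astar, t ≠ 0 ∧ s * a = t * b := by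
  obtain ⟨s, hs, hs0, t, h⟩ := hj.ore a hb hb0
  have ht0 : t ≠ 0 := by
    rintro rfl
    rw [zero_mul] at h
    exact mul_ne_zero_alg hg hs0 ha0 h
  refine ⟨s, hs, hs0, t, mem_Astar_of_ddeg_eq_zero hg hm ?_, ht0, h⟩
  have h1 := congrArg ddeg h
  rw [ddeg_mul hg hm hs0 ha0, ddeg_mul hg hm ht0 hb0, ddeg_eq_zero_of_mem_Astar hg hm hs,
    ddeg_eq_zero_of_mem_Astar hg hm ha, ddeg_eq_zero_of_mem_Astar hg hm hb] at h1
  omega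

lemma IsOreLocalizedAt.nontrivial (hg : g.IsGAlgebra m) (hj : g.IsOreLocalizedAt j) :
    Nontrivial R := by
  refine ⟨j (g.mon 0), 0, hj.map_ne_zero fun h => ?_⟩
  have := coeffs_mon hg 0
  rw [h, coeffs_zero hg] at this
  simpa using DFunLike.congr_fun this 0

/-- For `x = s⁻¹ f` and `y = t⁻¹ h`, the Ore condition `a f = f' t` gives `a s x y = f' h`, which is
nonzero in the domain `R_*`. -/
lemma IsOreLocalizedAt.noZeroDivisors (hg : g.IsGAlgebra m) (hj : g.IsOreLocalizedAt j) :
    NoZeroDivisors R where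
  eq_zero_or_eq_zero_of_mul_eq_zero := by
    intro x y hxy
    by_contra! hne
    obtain ⟨hx, hy⟩ := hne
    obtain ⟨s, hs, hs0, f, hf⟩ := hj.fraction x
    obtain ⟨t, ht, ht0, h, hh⟩ := hj.fraction y
    have hf0 : f ≠ 0 := by
      rintro rfl
      rw [map_zero, (hj.isUnit s hs hs0).mul_right_eq_zero] at hf
      exact hx hf
    have hh0 : h ≠ 0 := by
      rintro rfl
      rw [map_zero, (hj.isUnit t ht ht0).mul_right_eq_zero] at hh
      exact hy hh
    obtain ⟨a, ha, ha0, f', haf⟩ := hj.ore f ht ht0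
    have hf'0 : f' ≠ 0 := by
      rintro rfl
      rw [zero_mul] at haf
      exact mul_ne_zero_alg hg ha0 hf0 haf
    have : j (f' * h) = 0 := by
      rw [map_mul, ← hh, ← mul_assoc, ← map_mul, ← haf, map_mul, ← hf, mul_assoc, mul_assoc, hxy,
        mul_zero, mul_zero]
    exact hj.map_ne_zero (mul_ne_zero_alg hg hf'0 hh0) this

/-- Pseudo-division: a step lowering the degree in the last variable. -/
lemma exists_pseudo_division (hg : g.IsGAlgebra m) (hm : LastDominates m)
    (hj : g.IsOreLocalizedAt j) {f c : g.Alg} (hf : f ≠ 0) (hc : c ≠ 0) (h : ddeg c ≤ ddeg f) :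
    ∃ a ∈ g.Astar, a ≠ 0 ∧ ∃ q, a * f - q * c ∈ degLT hg (ddeg f) := by
  set d := ddeg f with hd
  have hpow : g.gen (Fin.last n) ^ (d - ddeg c) ∈ degLT hg (d - ddeg c + 1) := by
    rw [gen_pow_eq_mon]
    exact mon_mem_degLT hg (by simp)
  have hpow0 : g.gen (Fin.last n) ^ (d - ddeg c) ≠ 0 := by
    rw [gen_pow_eq_mon]
    intro h0
    have := coeffs_mon hg (Finsupp.single (Fin.last n) (d - ddeg c))
    rw [h0, coeffs_zero hg] at this
    simpa using DFunLike.congr_fun this (Finsupp.single (Fin.last n) (d - ddeg c))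
  have hpowdeg : ddeg (g.gen (Fin.last n) ^ (d - ddeg c)) = d - ddeg c := by
    have hle := (mem_degLT_succ hg).1 hpow
    refine le_antisymm hle ?_
    have : g.coeffs (g.gen (Fin.last n) ^ (d - ddeg c))
        (Finsupp.single (Fin.last n) (d - ddeg c)) ≠ 0 := by
      rw [gen_pow_eq_mon, coeffs_mon hg]; simp
    simpa using le_ddeg this
  -- `c` is raised to the degree of `f`. Leading coefficients stand to the left of `∂ ^ d`, so left
  -- multiples `a`, `b` from `A_*` with `a u = b v` cancel the top terms without being moved past
  -- `∂`.
  set c' := g.gen (Fin.last n) ^ (d - ddeg c) * c with hc'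
  have hc'0 : c' ≠ 0 := mul_ne_zero_alg hg hpow0 hc
  have hc'deg : ddeg c' = d := by
    rw [hc', ddeg_mul hg hm hpow0 hc, hpowdeg]; omega
  have lead : ∀ {x : g.Alg}, x ≠ 0 → ddeg x = d → ∃ u ∈ g.Astar, u ≠ 0 ∧
      x - u * g.gen (Fin.last n) ^ d ∈ degLT hg d := by
    intro x hx hxd
    obtain ⟨u, hu, hu'⟩ := exists_sub_mul_pow_mem_degLT hg hm ((mem_degLT_succ hg).2 hxd.le)
    refine ⟨u, hu, ?_, hu'⟩
    rintro rfl
    rw [zero_mul, sub_zero, mem_degLT_iff hg] at hu'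
    rcases hu' with h | h
    · exact hx h
    · omega
  obtain ⟨u, hu, hu0, hfu⟩ := lead hf hd.symm
  obtain ⟨v, hv, hv0, hcv⟩ := lead hc'0 hc'deg
  obtain ⟨a, ha, ha0, b, hb, hb0, hab⟩ := hj.ore_Astar hg hm hu hu0 hv hv0
  refine ⟨a, ha, ha0, b * g.gen (Fin.last n) ^ (d - ddeg c), ?_⟩
  have h1 := mul_mem_degLT hg hm (d := 0) ((mem_Astar_iff hg hm).1 ha) hfu
  have h2 := mul_mem_degLT hg hm (d := 0) ((mem_Astar_iff hg hm).1 hb) hcv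
  rw [zero_add] at h1 h2
  have e : a * f - b * g.gen (Fin.last n) ^ (d - ddeg c) * c =
      a * (f - u * g.gen (Fin.last n) ^ d) - b * (c' - v * g.gen (Fin.last n) ^ d) := by
    rw [mul_sub, mul_sub, ← mul_assoc a u, ← mul_assoc b v, hab, hc', ← mul_assoc b]
    abel
  rw [e]
  exact Submodule.sub_mem _ h1 h2

/-- A left ideal is generated by any nonzero element of the G-algebra that has minimal degree. -/
lemma ideal_eq_span_of_ddeg_minimal (hg : g.IsGAlgebra m) (hm : LastDominates m)
    (hj : g.IsOreLocalizedAt j) {I : Ideal R} {c : g.Alg} (hc : c ≠ 0) (hcI : j c ∈ I)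
    (hmin : ∀ f, f ≠ 0 → j f ∈ I → ddeg c ≤ ddeg f) : I = Ideal.span {j c} := by
  refine le_antisymm ?_ ((Ideal.span_singleton_le_iff_mem _).2 hcI)
  have key : ∀ (d : ℕ) (f : g.Alg), f ∈ degLT hg d → j f ∈ I → j f ∈ Ideal.span {j c} := by
    intro d
    induction d with
    | zero =>
      intro f hf _
      rcases (mem_degLT_iff hg).1 hf with rfl | h
      · rw [map_zero]; exact Ideal.zero_mem _
      · omega
    | succ d ih =>
      intro f hf hfI
      by_cases hf0 : f = 0
      · rw [hf0, map_zero]; exact Ideal.zero_mem _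
      obtain ⟨a, ha, ha0, q, hq⟩ := exists_pseudo_division hg hm hj hf0 hc (hmin f hf0 hfI)
      have hcs : j (q * c) ∈ Ideal.span {j c} := by
        rw [map_mul]
        exact Ideal.mul_mem_left _ _ (Ideal.mem_span_singleton_self _)
      have hlow : a * f - q * c ∈ degLT hg d := by
        have h1 := (mem_degLT_succ hg).1 hf
        exact fun α hα => lt_of_lt_of_le (hq α hα) h1
      have h2 := ih _ hlow (by
        rw [map_sub, map_mul, map_mul]
        exact Ideal.sub_mem _ (Ideal.mul_mem_left _ _ hfI) (Ideal.mul_mem_left _ _ hcI))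
      rw [map_sub] at h2
      have h3 := Ideal.add_mem _ h2 hcs
      rw [sub_add_cancel, map_mul] at h3
      -- The factor `a` introduced by the pseudo-division is a unit of `R` and can be removed.
      obtain ⟨u, hu⟩ := hj.isUnit a ha ha0
      have h4 := Ideal.mul_mem_left _ (↑u⁻¹ : R) h3
      rwa [← hu, Units.inv_mul_cancel_left] at h4
  intro r hr
  obtain ⟨s, hs, hs0, f, hf⟩ := hj.fraction r
  have h1 : j f ∈ Ideal.span {j c} := key (ddeg f + 1) f ((mem_degLT_succ hg).2 le_rfl)
    (hf ▸ Ideal.mul_mem_left _ _ hr)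
  obtain ⟨u, hu⟩ := hj.isUnit s hs hs0
  have h4 := Ideal.mul_mem_left _ (↑u⁻¹ : R) h1
  rwa [← hf, ← hu, Units.inv_mul_cancel_left] at h4

lemma IsOreLocalizedAt.isPrincipalIdealRing (hg : g.IsGAlgebra m) (hm : LastDominates m)
    (hj : g.IsOreLocalizedAt j) : IsPrincipalIdealRing R := by
  refine ⟨fun I => ?_⟩
  by_cases hI : ∃ f, f ≠ 0 ∧ j f ∈ I
  · classical
    let P : ℕ → Prop := fun d => ∃ f, f ≠ 0 ∧ j f ∈ I ∧ ddeg f = d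
    have hP : ∃ d, P d := by
      obtain ⟨f, hf, hfI⟩ := hI
      exact ⟨_, f, hf, hfI, rfl⟩
    obtain ⟨c, hc, hcI, hcd⟩ := Nat.find_spec hP
    refine ⟨j c, ideal_eq_span_of_ddeg_minimal hg hm hj hc hcI fun f hf hfI => ?_⟩
    rw [hcd]
    exact Nat.find_min' hP ⟨f, hf, hfI, rfl⟩
  · refine ⟨0, ?_⟩
    rw [Submodule.span_zero_singleton, Submodule.eq_bot_iff]
    intro r hr
    obtain ⟨s, hs, hs0, f, hf⟩ := hj.fraction r
    by_contra hr0
    refine hI ⟨f, ?_, hf ▸ Ideal.mul_mem_left _ _ hr⟩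
    rintro rfl
    rw [map_zero, (hj.isUnit s hs hs0).mul_right_eq_zero] at hf
    exact hr0 hf

/-- Principal left ideals make `R` left Noetherian. The rank condition is what makes `q + 1` vectors
of `R^q` dependent. -/
lemma IsOreLocalizedAt.strongRankCondition (hg : g.IsGAlgebra m) (hm : LastDominates m)
    (hj : g.IsOreLocalizedAt j) : StrongRankCondition R := by
  have := hj.isPrincipalIdealRing hg hm
  have := hj.nontrivial hg
  infer_instance

/-- An element of the `R`-module generated by `N` becomes an element of `N` after multiplication
by a common denominator. -/
lemma IsOreLocalizedAt.clear_denominators (hg : g.IsGAlgebra m) (hm : LastDominates m)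
    (hj : g.IsOreLocalizedAt j) {l p : ℕ} (Ms : Matrix (Fin l) (Fin p) g.Alg) {w : Fin p → R}
    (hw : w ∈ rowModule (Ms.map j)) : ∃ s ∈ g.Astar, s ≠ 0 ∧ ∃ v ∈ rowModule Ms,
      ∀ k, j s * w k = j (v k) := by
  have h10 : (1 : g.Alg) ≠ 0 := by
    rintro h
    have := hj.nontrivial hg
    exact one_ne_zero (α := R) (by rw [← map_one j, h, map_zero])
  induction hw using Submodule.span_induction with
  | mem x hx =>
    obtain ⟨i, rfl⟩ := hx
    refine ⟨1, Subalgebra.one_mem _, h10, Ms.row i, Submodule.subset_span ⟨i, rfl⟩, fun k => ?_⟩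
    rw [map_one, one_mul]
    rfl
  | zero => exact ⟨1, Subalgebra.one_mem _, h10, 0, Submodule.zero_mem _, by simp⟩
  | add x y _ _ hx hy =>
    obtain ⟨s, hs, hs0, v, hv, hsv⟩ := hx
    obtain ⟨t, ht, ht0, w, hw, htw⟩ := hy
    obtain ⟨a, ha, ha0, b, hb, hb0, hab⟩ := hj.ore_Astar hg hm hs hs0 ht ht0
    refine ⟨a * s, Subalgebra.mul_mem _ ha hs, mul_ne_zero_alg hg ha0 hs0, a • v + b • w,
      Submodule.add_mem _ (Submodule.smul_mem _ _ hv) (Submodule.smul_mem _ _ hw), fun k => ?_⟩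
    rw [Pi.add_apply, mul_add]
    conv_lhs => enter [2]; rw [hab]
    simp only [map_mul, mul_assoc, hsv, htw, Pi.add_apply, Pi.smul_apply, smul_eq_mul, map_add]
  | smul r x _ hx =>
    obtain ⟨s, hs, hs0, v, hv, hsv⟩ := hx
    obtain ⟨u, hu⟩ := hj.isUnit s hs hs0
    -- From `r s⁻¹ = t⁻¹ f` it follows that `t r x = f s x = f v`.
    obtain ⟨t, ht, ht0, f, hf⟩ := hj.fraction (r * ↑u⁻¹)
    refine ⟨t, ht, ht0, f • v, Submodule.smul_mem _ _ hv, fun k => ?_⟩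
    rw [Pi.smul_apply, Pi.smul_apply, smul_eq_mul, smul_eq_mul, map_mul, ← hsv, ← hf, ← hu]
    simp [mul_assoc]

end GData

/-! ## Existence of reduced Gröbner bases -/

namespace GData

variable {K : Type*} [Field K] {n p : ℕ} {g : GData K n} {m : MonomialOrder (Fin n)}

/-- The position-over-term ordering as a linear order. -/
noncomputable def potKey (m : MonomialOrder (Fin n)) (μ : Fin p × (Fin n →₀ ℕ)) : Fin p ×ₗ m.syn :=
  toLex (μ.1, m.toSyn μ.2)

lemma potLE_iff {μ ν : Fin p × (Fin n →₀ ℕ)} : potLE m μ ν ↔ potKey m μ ≤ potKey m ν := by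
  rw [potKey, potKey, Prod.Lex.toLex_le_toLex, potLE]

lemma potKey_injective : Function.Injective (potKey (p := p) m) := by
  rintro ⟨i, α⟩ ⟨k, β⟩ h
  have h := Prod.ext_iff.1 (toLex.injective h)
  exact Prod.ext h.1 (m.toSyn.injective h.2)

lemma vcoeff_zero (hg : g.IsGAlgebra m) (μ : Fin p × (Fin n →₀ ℕ)) : g.vcoeff 0 μ = 0 := by
  rw [vcoeff, Pi.zero_apply, coeffs_zero hg]; rfl

lemma vcoeff_add (hg : g.IsGAlgebra m) (f h : Fin p → g.Alg) (μ : Fin p × (Fin n →₀ ℕ)) :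
    g.vcoeff (f + h) μ = g.vcoeff f μ + g.vcoeff h μ := by
  rw [vcoeff, Pi.add_apply, coeffs_add hg]; rfl

lemma vcoeff_sub (hg : g.IsGAlgebra m) (f h : Fin p → g.Alg) (μ : Fin p × (Fin n →₀ ℕ)) :
    g.vcoeff (f - h) μ = g.vcoeff f μ - g.vcoeff h μ := by
  rw [vcoeff, Pi.sub_apply, coeffs_sub hg]; rfl

lemma vcoeff_smul (hg : g.IsGAlgebra m) (a : K) (f : Fin p → g.Alg)
    (μ : Fin p × (Fin n →₀ ℕ)) : g.vcoeff (a • f) μ = a * g.vcoeff f μ := by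
  rw [vcoeff, Pi.smul_apply, coeffs_smul hg]; rfl

variable (g) in
/-- The module monomial `x ^ α e_i`. -/
noncomputable def vmon (μ : Fin p × (Fin n →₀ ℕ)) : Fin p → g.Alg := Pi.single μ.1 (g.mon μ.2)

lemma vcoeff_vmon_self (hg : g.IsGAlgebra m) (μ : Fin p × (Fin n →₀ ℕ)) :
    g.vcoeff (g.vmon μ) μ = 1 := by
  rw [vcoeff, vmon, Pi.single_eq_same, coeffs_mon hg, Finsupp.single_eq_same]

lemma vcoeff_vmon_ne (hg : g.IsGAlgebra m) {μ ν : Fin p × (Fin n →₀ ℕ)} (h : ν ≠ μ) :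
    g.vcoeff (g.vmon μ) ν = 0 := by
  rw [vcoeff, vmon]
  by_cases h1 : ν.1 = μ.1
  · rw [h1, Pi.single_eq_same, coeffs_mon hg, Finsupp.single_eq_of_ne]
    exact fun h2 => h (Prod.ext h1 h2)
  · rw [Pi.single_eq_of_ne h1, coeffs_zero hg]; rfl

lemma isLM_iff (hg : g.IsGAlgebra m) {f : Fin p → g.Alg} {i : Fin p} {α : Fin n →₀ ℕ} :
    g.IsLM m f (i, α) ↔ g.IsLead m (f i) α ∧ ∀ k, i < k → f k = 0 := by
  constructor
  · rintro ⟨h1, h2⟩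
    refine ⟨⟨h1, fun β hβ => ?_⟩, fun k hk => ?_⟩
    · rcases h2 (i, β) hβ with h | h
      · exact absurd h (lt_irrefl _)
      · exact h.2
    · rw [← coeffs_eq_zero hg]
      ext β
      by_contra hne
      rcases h2 (k, β) hne with h | h
      · exact absurd h hk.not_gt
      · exact hk.ne' h.1
  · rintro ⟨h1, h2⟩
    refine ⟨h1.1, fun ν hν => ?_⟩
    rcases lt_trichotomy ν.1 i with h | h | h
    · exact Or.inl h
    · exact Or.inr ⟨h, h1.2 _ (by rw [← h]; exact hν)⟩
    · rw [vcoeff, h2 _ h, coeffs_zero hg] at hν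
      exact absurd rfl hν

lemma exists_isLM (hg : g.IsGAlgebra m) {f : Fin p → g.Alg} (hf : f ≠ 0) :
    ∃ μ, g.IsLM m f μ := by
  classical
  obtain ⟨k, hk⟩ := Function.ne_iff.1 hf
  obtain ⟨i, hi, hmax⟩ := Finset.exists_max_image (Finset.univ.filter fun i => f i ≠ 0) id
    ⟨k, by simpa using hk⟩
  simp only [Finset.mem_filter, Finset.mem_univ, true_and, id] at hi hmax
  obtain ⟨α, hα⟩ := exists_isLead hg hi
  refine ⟨(i, α), (isLM_iff hg).2 ⟨hα, fun k hk => ?_⟩⟩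
  by_contra h
  exact absurd (hmax k h) (not_le.2 hk)

lemma IsLM.unique {f : Fin p → g.Alg} {μ ν : Fin p × (Fin n →₀ ℕ)} (h1 : g.IsLM m f μ)
    (h2 : g.IsLM m f ν) : μ = ν :=
  potKey_injective (m := m) (le_antisymm (potLE_iff.1 (h2.2 μ h1.1)) (potLE_iff.1 (h1.2 ν h2.1)))

variable (m) in
/-- The set of leading monomials of the elements of a submodule. -/
def leadMons (N : Submodule g.Alg (Fin p → g.Alg)) : Set (Fin p × (Fin n →₀ ℕ)) :=
  {μ | ∃ f ∈ N, g.IsLM m f μ}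

lemma smul_mem_of_mem {N : Submodule g.Alg (Fin p → g.Alg)} {f : Fin p → g.Alg} (a : K)
    (hf : f ∈ N) : a • f ∈ N := by
  rw [← algebraMap_smul g.Alg a f]
  exact N.smul_mem _ hf

lemma mem_leadMons_of_monDvd (hg : g.IsGAlgebra m) {N : Submodule g.Alg (Fin p → g.Alg)}
    {μ ν : Fin p × (Fin n →₀ ℕ)} (hμ : μ ∈ leadMons m N) (h : monDvd μ ν) :
    ν ∈ leadMons m N := by
  obtain ⟨f, hf, hlm⟩ := hμ
  obtain ⟨i, α⟩ := μ
  obtain ⟨k, β⟩ := ν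
  obtain ⟨rfl, hle⟩ : i = k ∧ α ≤ β := h
  obtain ⟨h1, h2⟩ := (isLM_iff hg).1 hlm
  refine ⟨g.mon (β - α) • f, N.smul_mem _ hf, (isLM_iff hg).2 ⟨?_, fun k hk => ?_⟩⟩
  · have hl : g.IsLead m (g.mon (β - α)) (β - α) := by
      rw [IsLead, coeffs_mon hg]
      refine ⟨by simp, fun γ hγ => ?_⟩
      rw [Finsupp.single_apply] at hγ
      split_ifs at hγ with he
      · rw [he]
      · exact absurd rfl hγ
    have := hl.mul hg h1
    rwa [tsub_add_cancel_of_le hle] at this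
  · rw [Pi.smul_apply, h2 k hk, smul_zero]

lemma exists_monic (hg : g.IsGAlgebra m) {N : Submodule g.Alg (Fin p → g.Alg)}
    {μ : Fin p × (Fin n →₀ ℕ)} (hμ : μ ∈ leadMons m N) :
    ∃ f ∈ N, g.vcoeff f μ = 1 ∧ ∀ ν, g.vcoeff f ν ≠ 0 → potKey m ν ≤ potKey m μ := by
  obtain ⟨f, hf, h1, h2⟩ := hμ
  refine ⟨(g.vcoeff f μ)⁻¹ • f, smul_mem_of_mem _ hf, ?_, fun ν hν => ?_⟩
  · rw [vcoeff_smul hg, inv_mul_cancel₀ h1]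
  · rw [vcoeff_smul hg] at hν
    exact potLE_iff.1 (h2 ν (right_ne_zero_of_mul hν))

/-- Division by the whole submodule instead of a finite basis: the top term of `h` is cancelled by
an element of `N` if its monomial is a leading one, and is moved into `r` otherwise. The bound `k`
carries the well-founded induction. -/
lemma exists_remainder (hg : g.IsGAlgebra m) (N : Submodule g.Alg (Fin p → g.Alg))
    (k : Fin p ×ₗ m.syn) (h : Fin p → g.Alg) (hk : ∀ ν, g.vcoeff h ν ≠ 0 → potKey m ν < k) :
    ∃ r, h - r ∈ N ∧ ∀ ν, g.vcoeff r ν ≠ 0 → ν ∉ leadMons m N ∧ potKey m ν < k := by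
  induction k using WellFoundedLT.induction generalizing h with
  | ind k ih =>
    by_cases h0 : h = 0
    · exact ⟨0, by rw [h0, sub_zero]; exact N.zero_mem,
        fun ν hν => absurd (vcoeff_zero hg ν) hν⟩
    obtain ⟨μ, hμ⟩ := exists_isLM hg h0
    have hlt := hk μ hμ.1
    have lower : ∀ f : Fin p → g.Alg, g.vcoeff f μ = 1 →
        (∀ ν, g.vcoeff f ν ≠ 0 → potKey m ν ≤ potKey m μ) →
        ∀ ν, g.vcoeff (h - g.vcoeff h μ • f) ν ≠ 0 → potKey m ν < potKey m μ := by
      intro f h1 h2 ν hν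
      rw [vcoeff_sub hg, vcoeff_smul hg] at hν
      refine lt_of_le_of_ne ?_ ?_
      · by_cases hz : g.vcoeff h ν = 0
        · rw [hz, zero_sub, neg_ne_zero] at hν
          exact h2 ν (right_ne_zero_of_mul hν)
        · exact potLE_iff.1 (hμ.2 ν hz)
      · intro he
        rw [potKey_injective he, h1, mul_one, sub_self] at hν
        exact hν rfl
    by_cases hL : μ ∈ leadMons m N
    · obtain ⟨f, hf, h1, h2⟩ := exists_monic hg hL
      obtain ⟨r, hr, hr'⟩ := ih _ hlt _ (lower f h1 h2)
      refine ⟨r, ?_, fun ν hν => ⟨(hr' ν hν).1, (hr' ν hν).2.trans hlt⟩⟩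
      have := N.add_mem hr (smul_mem_of_mem (g.vcoeff h μ) hf)
      rwa [sub_right_comm, sub_add_cancel] at this
    · obtain ⟨r, hr, hr'⟩ := ih _ hlt _ (lower (g.vmon μ) (vcoeff_vmon_self hg μ) fun ν hν => by
        by_contra hne
        exact hν (vcoeff_vmon_ne hg fun he => hne (he ▸ le_rfl)))
      refine ⟨r + g.vcoeff h μ • g.vmon μ, ?_, fun ν hν => ?_⟩
      · rwa [add_comm, ← sub_sub]
      · by_cases he : ν = μ
        · rw [he]; exact ⟨hL, hlt⟩
        · rw [vcoeff_add hg, vcoeff_smul hg, vcoeff_vmon_ne hg he, mul_zero, add_zero] at hν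
          exact ⟨(hr' ν hν).1, (hr' ν hν).2.trans hlt⟩

/-- The tail of a monic element with leading monomial `μ` is replaced by its remainder modulo `N`.
These elements, for `μ` minimal under divisibility, make up the reduced basis. -/
lemma exists_reduced_monic (hg : g.IsGAlgebra m) {N : Submodule g.Alg (Fin p → g.Alg)}
    {μ : Fin p × (Fin n →₀ ℕ)} (hμ : μ ∈ leadMons m N) :
    ∃ f ∈ N, g.IsLM m f μ ∧ g.vcoeff f μ = 1 ∧
      ∀ ν, g.vcoeff f ν ≠ 0 → ν ≠ μ → ν ∉ leadMons m N := by
  obtain ⟨f, hf, h1, h2⟩ := exists_monic hg hμ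
  obtain ⟨r, hr, hr'⟩ := exists_remainder hg N (potKey m μ) (f - g.vmon μ) (by
    intro ν hν
    by_cases he : ν = μ
    · rw [he, vcoeff_sub hg, h1, vcoeff_vmon_self hg, sub_self] at hν
      exact absurd rfl hν
    · rw [vcoeff_sub hg, vcoeff_vmon_ne hg he, sub_zero] at hν
      exact lt_of_le_of_ne (h2 ν hν) fun h => he (potKey_injective h))
  have hrμ : g.vcoeff r μ = 0 := by
    by_contra h
    exact lt_irrefl _ (hr' μ h).2
  have hone : g.vcoeff (g.vmon μ + r) μ = 1 := by
    rw [vcoeff_add hg, vcoeff_vmon_self hg, hrμ, add_zero]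
  have hother : ∀ ν, g.vcoeff (g.vmon μ + r) ν ≠ 0 → ν ≠ μ → g.vcoeff r ν ≠ 0 := by
    intro ν hν hne
    rwa [vcoeff_add hg, vcoeff_vmon_ne hg hne, zero_add] at hν
  refine ⟨g.vmon μ + r, ?_, ⟨?_, fun ν hν => ?_⟩, hone, fun ν hν hne => (hr' ν (hother ν hν hne)).1⟩
  · have := N.sub_mem hf hr
    rwa [sub_sub, sub_sub_cancel] at this
  · rw [hone]; exact one_ne_zero
  · by_cases he : ν = μ
    · rw [he]; exact potLE_iff.2 le_rfl
    · exact potLE_iff.2 (hr' ν (hother ν hν he)).2.le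

theorem exists_isReducedGroebner (hg : g.IsGAlgebra m) (N : Submodule g.Alg (Fin p → g.Alg)) :
    ∃ G, g.IsReducedGroebner m N G := by
  choose! H hN hLM hone hred using
    fun (μ : Fin p × (Fin n →₀ ℕ)) (hμ : μ ∈ leadMons m N) => exists_reduced_monic hg hμ
  let S : Fin p → Set (Fin n →₀ ℕ) := fun i => {α | (i, α) ∈ leadMons m N}
  let T : Fin p → Set (Fin n →₀ ℕ) := fun i => {α | Minimal (· ∈ S i) α}
  have hTS : ∀ {i α}, α ∈ T i → (i, α) ∈ leadMons m N := fun h => h.prop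
  refine ⟨⋃ i, (fun α => H (i, α)) '' T i, ?_, ?_, ?_, ?_, ?_⟩
  · refine Set.finite_iUnion fun i => Set.Finite.image _ ?_
    -- Dickson's lemma: the minimal exponents form an antichain in a well-quasi-order.
    exact IsAntichain.finite_of_partiallyWellOrderedOn (setOfPred_minimal_antichain _)
      (Set.isPWO_of_wellQuasiOrderedLE _)
  · intro h hh
    obtain ⟨i, α, hα, rfl⟩ := Set.mem_iUnion.1 hh
    refine ⟨hN _ (hTS hα), fun h0 => (hLM _ (hTS hα)).1 ?_⟩
    dsimp only at h0
    rw [h0, vcoeff_zero hg]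
  · intro f hf hf0
    obtain ⟨⟨i, β⟩, hβ⟩ := exists_isLM hg hf0
    obtain ⟨α, hle, hα⟩ := exists_minimal_le_of_wellFoundedLT (· ∈ S i) β ⟨f, hf, hβ⟩
    exact ⟨H (i, α), Set.mem_iUnion.2 ⟨i, α, hα, rfl⟩, (i, α), (i, β), hLM _ (hTS hα), hβ, rfl, hle⟩
  · intro h hh μ hμ
    obtain ⟨i, α, hα, rfl⟩ := Set.mem_iUnion.1 hh
    rw [hμ.unique (hLM _ (hTS hα))]
    exact hone _ (hTS hα)
  · intro h hh h' hh' hne μ hμ ν hν hdvd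
    obtain ⟨i, α, hα, rfl⟩ := Set.mem_iUnion.1 hh
    obtain ⟨k, β, hβ, rfl⟩ := Set.mem_iUnion.1 hh'
    have hμe := hμ.unique (hLM _ (hTS hβ))
    subst hμe
    by_cases hν' : ν = (i, α)
    · subst hν'
      obtain ⟨rfl, hle⟩ : k = i ∧ β ≤ α := hdvd
      exact hne (by rw [le_antisymm hle (hα.le_of_le hβ.prop hle)])
    · exact hred _ (hTS hα) ν hν hν' (mem_leadMons_of_monDvd hg (hTS hβ) hdvd)

theorem exists_isGStar (hg : g.IsGAlgebra m) {l : ℕ} (Ms : Matrix (Fin l) (Fin p) g.Alg)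
    (h : ∀ i, ∃ f ∈ rowModule Ms, f i ≠ 0 ∧ ∀ k, i < k → f k = 0) :
    ∃ B : Matrix (Fin p) (Fin p) g.Alg, g.IsGStar m Ms B := by
  obtain ⟨G, hG⟩ := exists_isReducedGroebner hg (rowModule Ms)
  have key : ∀ i, ∃ b ∈ G, ∃ α, g.IsLM m b (i, α) ∧
      ∀ h ∈ G, ∀ β, g.IsLM m h (i, β) → m.toSyn α ≤ m.toSyn β := by
    intro i
    obtain ⟨f, hf, hfi, hfk⟩ := h i
    obtain ⟨α, hα⟩ := exists_isLead hg hfi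
    obtain ⟨b, hb, μ, ν, hμ, hν, hdvd⟩ := hG.groebner f hf fun h0 => hfi (by rw [h0]; rfl)
    have hμ1 : μ.1 = i := by
      rw [hdvd.1, hν.unique ((isLM_iff hg).2 ⟨hα, hfk⟩)]
    obtain ⟨s, ⟨b', hb', β, hβ, rfl⟩, hmin⟩ := wellFounded_lt.has_min
      {s : m.syn | ∃ b ∈ G, ∃ α, g.IsLM m b (i, α) ∧ s = m.toSyn α}
      ⟨_, b, hb, μ.2, by rw [← hμ1]; exact hμ, rfl⟩
    exact ⟨b', hb', β, hβ, fun h hh γ hγ => not_lt.1 (hmin _ ⟨h, hh, γ, hγ, rfl⟩)⟩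
  choose B hB using key
  exact ⟨Matrix.of B, G, hG, hB⟩

end GData

/-! ## Square matrices of full rank -/

/-- `e_i` and the `q` rows are `q + 1` vectors in `R^q`, hence dependent; independence of the rows
forces a nonzero coefficient at `e_i`. -/
lemma exists_smul_single_mem_rowModule {R : Type*} [Ring R] [StrongRankCondition R] {q : ℕ}
    {M : Matrix (Fin q) (Fin q) R} (hM : LinearIndependent R M.row) (i : Fin q) :
    ∃ r : R, r ≠ 0 ∧ r • (Pi.single i 1 : Fin q → R) ∈ rowModule M := by
  have hdep : ¬ LinearIndependent R
      (Fin.cons (Pi.single i 1 : Fin q → R) M.row : Fin (q + 1) → Fin q → R) := by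
    intro h
    have := h.fintype_card_le_finrank
    simp at this
  obtain ⟨c, hc, k, hk⟩ := Fintype.not_linearIndependent_iff.1 hdep
  rw [Fin.sum_univ_succ] at hc
  simp only [Fin.cons_zero, Fin.cons_succ] at hc
  refine ⟨c 0, fun h0 => ?_, ?_⟩
  · rw [h0, zero_smul, zero_add] at hc
    have := Fintype.linearIndependent_iff.1 hM _ hc
    cases k using Fin.cases with
    | zero => exact hk h0
    | succ k => exact hk (this k)
  · rw [eq_neg_of_add_eq_zero_left hc]
    exact Submodule.neg_mem _ (Submodule.sum_mem _ fun k _ =>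
      Submodule.smul_mem _ _ (Submodule.subset_span ⟨k, rfl⟩))

/-- In column `i` of a relation the later rows vanish and the earlier coefficients are zero by
induction, leaving `c i * T i i = 0`. -/
lemma linearIndependent_row_of_upperTriangular {R : Type*} [Ring R] [NoZeroDivisors R] {q : ℕ}
    {T : Matrix (Fin q) (Fin q) R} (hT : ∀ i k, k < i → T i k = 0) (hd : ∀ i, T i i ≠ 0) :
    LinearIndependent R T.row := by
  refine Fintype.linearIndependent_iff.2 fun c hc i => ?_
  induction i using WellFoundedLT.induction with
  | ind i ih =>
    have h := congrFun hc i
    rw [Finset.sum_apply, Finset.sum_eq_single i] at h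
    · exact (mul_eq_zero.1 h).resolve_right (hd i)
    · intro k _ hk
      rcases hk.lt_or_gt with h | h
      · rw [ih k h, zero_smul, Pi.zero_apply]
      · show c k * T k i = 0
        rw [hT k i h, mul_zero]
    · exact fun h => absurd (Finset.mem_univ _) h

/-! ### Existence and shape of `G^*`, and the ideal of last entries. -/

namespace GData

variable {K : Type*} [Field K] {n : ℕ} {g : GData K (n + 1)} {m : MonomialOrder (Fin (n + 1))}
  {R : Type*} [Ring R] {j : g.Alg →+* R}

/-- A nonzero multiple of `e_i`, cleared of denominators, lies in the module over the G-algebra and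
has leading position exactly `i`. -/
theorem exists_isGStar_of_linearIndependent (hg : g.IsGAlgebra m) (hm : LastDominates m)
    (hj : g.IsOreLocalizedAt j) {q l : ℕ} {M : Matrix (Fin q) (Fin q) R}
    (hM : LinearIndependent R M.row) (Ms : Matrix (Fin l) (Fin q) g.Alg)
    (hMs : rowModule (Ms.map j) = rowModule M) :
    ∃ B : Matrix (Fin q) (Fin q) g.Alg, g.IsGStar m Ms B := by
  have := hj.strongRankCondition hg hm
  refine exists_isGStar hg Ms fun i => ?_
  obtain ⟨r, hr, hmem⟩ := exists_smul_single_mem_rowModule hM i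
  rw [← hMs] at hmem
  obtain ⟨s, hs, hs0, v, hv, hsv⟩ := hj.clear_denominators hg hm Ms hmem
  refine ⟨v, hv, fun h0 => hr ?_, fun k hk => ?_⟩
  · have := hsv i
    rw [h0, map_zero, (hj.isUnit s hs hs0).mul_right_eq_zero] at this
    simpa using this
  · have := hsv k
    rw [Pi.smul_apply, Pi.single_eq_of_ne hk.ne', smul_zero, mul_zero] at this
    exact (map_eq_zero_iff j hj.injective).1 this.symm

lemma IsGStar.eq_zero_of_lt (hg : g.IsGAlgebra m) {q l : ℕ} {Ms : Matrix (Fin l) (Fin q) g.Alg}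
    {B : Matrix (Fin q) (Fin q) g.Alg} (hB : g.IsGStar m Ms B) {i k : Fin q} (h : i < k) :
    B i k = 0 := by
  obtain ⟨G, _, hrow⟩ := hB
  obtain ⟨_, α, hα, _⟩ := hrow i
  exact ((isLM_iff hg).1 hα).2 k h

lemma IsGStar.diag_ne_zero (hg : g.IsGAlgebra m) {q l : ℕ} {Ms : Matrix (Fin l) (Fin q) g.Alg}
    {B : Matrix (Fin q) (Fin q) g.Alg} (hB : g.IsGStar m Ms B) (i : Fin q) : B i i ≠ 0 := by
  obtain ⟨G, _, hrow⟩ := hB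
  obtain ⟨_, α, hα, _⟩ := hrow i
  exact ((isLM_iff hg).1 hα).1.ne_zero hg

lemma IsGStar.row_mem {m : MonomialOrder (Fin (n + 1))} {q l : ℕ}
    {Ms : Matrix (Fin l) (Fin q) g.Alg} {B : Matrix (Fin q) (Fin q) g.Alg}
    (hB : g.IsGStar m Ms B) (i : Fin q) : B.row i ∈ rowModule Ms := by
  obtain ⟨G, hG, hrow⟩ := hB
  exact (hG.subset _ (hrow i).1).1

/-- The last diagonal entry has minimal degree among the last entries of the row module. -/
lemma IsGStar.ddeg_last_le (hg : g.IsGAlgebra m) (hm : LastDominates m) {p l : ℕ}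
    {Ms : Matrix (Fin l) (Fin (p + 1)) g.Alg} {B : Matrix (Fin (p + 1)) (Fin (p + 1)) g.Alg}
    (hB : g.IsGStar m Ms B) {f : Fin (p + 1) → g.Alg} (hf : f ∈ rowModule Ms)
    (hf0 : f (Fin.last p) ≠ 0) :
    ddeg (B (Fin.last p) (Fin.last p)) ≤ ddeg (f (Fin.last p)) := by
  obtain ⟨G, hG, hrow⟩ := hB
  obtain ⟨_, α, hα, hmin⟩ := hrow (Fin.last p)
  obtain ⟨β, hβ⟩ := exists_isLead hg hf0
  obtain ⟨b, hb, μ, ν, hμ, hν, hdvd⟩ := hG.groebner f hf fun h0 => hf0 (by rw [h0]; rfl)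
  -- No position follows the last one, so a nonzero last entry already contains the leading monomial
  -- of the whole vector.
  have hνe : ν = (Fin.last p, β) :=
    hν.unique ((isLM_iff hg).2 ⟨hβ, fun k hk => absurd (Fin.le_last k) (not_le.2 hk)⟩)
  subst hνe
  obtain ⟨i, γ⟩ := μ
  obtain ⟨rfl, hle⟩ : i = Fin.last p ∧ γ ≤ β := hdvd
  have h1 : m.toSyn α ≤ m.toSyn β := (hmin b hb γ hμ).trans (m.toSyn_monotone hle)
  have h2 : g.IsLead m (B (Fin.last p) (Fin.last p)) α := ((isLM_iff hg).1 hα).1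
  rw [h2.ddeg_eq hm, hβ.ddeg_eq hm]
  exact hm.last_le h1

/-- The last diagonal entry of `G^*` generates the left ideal of the last entries of the
`R`-module generated by the rows. -/
theorem IsGStar.span_last_eq_map_proj (hg : g.IsGAlgebra m) (hm : LastDominates m)
    (hj : g.IsOreLocalizedAt j) {p l : ℕ} {Ms : Matrix (Fin l) (Fin (p + 1)) g.Alg}
    {B : Matrix (Fin (p + 1)) (Fin (p + 1)) g.Alg} (hB : g.IsGStar m Ms B) :
    (rowModule (Ms.map j)).map (LinearMap.proj (Fin.last p)) =
      Ideal.span {j (B (Fin.last p) (Fin.last p))} := by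
  have hmap : ∀ v ∈ rowModule Ms, (fun k => j (v k)) ∈ rowModule (Ms.map j) := by
    intro v hv
    induction hv using Submodule.span_induction with
    | mem x hx =>
      obtain ⟨i, rfl⟩ := hx
      exact Submodule.subset_span ⟨i, rfl⟩
    | zero =>
      simp only [Pi.zero_apply, map_zero]
      exact (rowModule (Ms.map j)).zero_mem
    | add x y _ _ hx hy =>
      simp only [Pi.add_apply, map_add]
      exact Submodule.add_mem _ hx hy
    | smul a x _ hx =>
      simp only [Pi.smul_apply, smul_eq_mul, map_mul]
      exact Submodule.smul_mem _ (j a) hx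
  refine ideal_eq_span_of_ddeg_minimal hg hm hj (hB.diag_ne_zero hg _)
    ⟨_, hmap _ (hB.row_mem (Fin.last p)), rfl⟩ fun f hf hfI => ?_
  obtain ⟨w, hw, hwf⟩ := hfI
  obtain ⟨s, hs, hs0, v, hv, hsv⟩ := hj.clear_denominators hg hm Ms hw
  have hlast : v (Fin.last p) = s * f := by
    refine hj.injective ?_
    rw [← hsv, map_mul, ← hwf]
    rfl
  -- The common denominator `s` lies in `A_*` and has degree 0, so minimality over the G-algebra
  -- passes to the `R`-module.
  have := hB.ddeg_last_le hg hm hv (hlast ▸ mul_ne_zero_alg hg hs0 hf)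
  rwa [hlast, ddeg_mul hg hm hs0 hf, ddeg_eq_zero_of_mem_Astar hg hm hs, zero_add] at this

end GData

theorem mainTheorem4 {K : Type*} [Field K] {n : ℕ} (g : GData K (n + 1))
    (m : MonomialOrder (Fin (n + 1))) (hg : g.IsGAlgebra m) (hm : GData.LastDominates m)
    {R : Type*} [Ring R] (j : g.Alg →+* R) (hj : g.IsOreLocalizedAt j)
    (θ : g.Alg →ₗ[K] g.Alg) (hθ : g.IsInvolution θ)
    {p : ℕ} (M : Matrix (Fin (p + 1)) (Fin (p + 1)) R) (hM : LinearIndependent R M.row)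
    {l : ℕ} (Ms : Matrix (Fin l) (Fin (p + 1)) g.Alg)
    (hMs : rowModule (Ms.map j) = rowModule M) :
    (∃ B : Matrix (Fin (p + 1)) (Fin (p + 1)) g.Alg, g.IsGStar m Ms B) ∧
    ∀ B : Matrix (Fin (p + 1)) (Fin (p + 1)) g.Alg, g.IsGStar m Ms B →
      ∀ (l' : ℕ) (Ns : Matrix (Fin l') (Fin (p + 1)) g.Alg),
        rowModule (Ns.map j) = rowModule ((g.thetaTilde θ B).map j) →
        (∃ C : Matrix (Fin (p + 1)) (Fin (p + 1)) g.Alg, g.IsGStar m Ns C) ∧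
        ∀ C : Matrix (Fin (p + 1)) (Fin (p + 1)) g.Alg, g.IsGStar m Ns C →
          Ideal.span (Set.range fun k => j (θ (B (Fin.last p) k))) =
            Ideal.span {j (C (Fin.last p) (Fin.last p))} := by
  refine ⟨GData.exists_isGStar_of_linearIndependent hg hm hj hM Ms hMs,
    fun B hB l' Ns hNs => ⟨?_, fun C hC => ?_⟩⟩
  · have := hj.noZeroDivisors hg
    refine GData.exists_isGStar_of_linearIndependent hg hm hj
      (linearIndependent_row_of_upperTriangular (fun i k hki => ?_) fun i => ?_) Ns hNs
    · show j (θ (B k i)) = 0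
      rw [hB.eq_zero_of_lt hg hki, map_zero, map_zero]
    · refine hj.map_ne_zero fun h0 => hB.diag_ne_zero hg i ?_
      rw [← hθ.invol (B i i)]
      exact (congrArg θ h0).trans (map_zero θ)
  -- The projection of a span is the span of the projected rows, and the last entry of row `k` of
  -- the matrix `thetaTilde θ B` is `θ (B_pk)`.
  · rw [← hC.span_last_eq_map_proj hg hm hj, hNs, rowModule, Submodule.map_span, ← Set.range_comp]
    rfl
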